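/- An operator system is a complex $*$-vector space $V$ together with cones $M_n(V)^+\subset M_n(V)_h$ ($n\ge 1$) such that $M_n(V)^+\cap -M_n(V)^+=\{0\}$ and $\alpha\, M_n(V)^+\alpha^*\subset M_m(V)^+$ for all $\alpha\in M_{m,n}(\mathbb C)$, and with an Archimedean matrix order unit $1_V$. It carries the norm $\|x\|=\inf\{r\ge 0:\begin{pmatrix} r1_V&x\\x^*&r1_V\end{pmatrix}\in M_2(V)^+\}$. The matrix algebra $M_n=M_n(\mathbb C)$ is an operator system with its usual positive cones and $1_{M_n}=I_n$. (The zero space is allowed, with $M_0=\{0\}$.) A linear map $f$ between spaces with such families of cones is completely positive if $[x_{ij}]\mapsto[f(x_{ij})]$ maps positive $n\times n$ matrices to positive ones for every $n$; it is unital if it preserves the units. For operator systems $\mathcal S,\mathcal T$, the spaces $\mathcal S\otimes_{\min}\mathcal T$ and $\mathcal S\otimes_{\max}\mathcal T$ are the algebraic tensor product $\mathcal S\otimes\mathcal T$ with unit $1_{\mathcal S}\otimes 1_{\mathcal T}$ and with the cones $$M_n(\mathcal S\otimes_{\min}\mathcal T)^+=\{[p_{ij}]\in M_n(\mathcal S\otimes\mathcal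 T): [(\varphi\otimes\psi)(p_{ij})]\in M_{nkm}^+ \text{ for all } k,m \text{ and all unital completely positive } \varphi:\mathcal S\to M_k,\ \psi:\mathcal T\to M_m\},$$ $$M_n(\mathcal S\otimes_{\max}\mathcal T)^+=\{X\in M_n(\mathcal S\otimes\mathcal T): X+\varepsilon I_n\otimes 1_{\mathcal S}\otimes 1_{\mathcal T}\in D_n(\mathcal S,\mathcal T)\text{ for all }\varepsilon>0\},$$ where $D_n(\mathcal S,\mathcal T)=\{\alpha(P\otimes Q)\alpha^*: P\in M_k(\mathcal S)^+,\ Q\in M_l(\mathcal T)^+,\ \alpha\in M_{n,kl}(\mathbb C),\ k,l\in\mathbb N\}$. Theorem. Let $\Phi:\mathcal S\to\mathcal T$ be a unital completely positive map between operator systems. The following are equivalent: (i) $\mathrm{id}_{\mathcal R}\otimes\Phi:\mathcal R\otimes_{\min}\mathcal S\to\mathcal R\otimes_{\max}\mathcal T$ is completely positive for every operator system $\mathcal R$; (ii) $\mathrm{id}_E\otimes\Phi:E\otimes_{\min}\mathcal S\to E\otimes_{\max}\mathcal T$ is completely positive for every finite-dimensional operator system $E$; (iii) there exist a directed set $\Lambda$,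 integers $n_\lambda$ ($\lambda\in\Lambda$) and unital completely positive maps $\varphi_\lambda:\mathcal S\to M_{n_\lambda}$ and $\psi_\lambda:M_{n_\lambda}\to\mathcal T$ such that $\|\psi_\lambda(\varphi_\lambda(x))-\Phi(x)\|\to 0$ for every $x\in\mathcal S$. -/

import Mathlib

open Filter Topology
open scoped TensorProduct Kronecker Matrix ComplexOrder

universe u

/-- The compression `α A α*` of a matrix `A` with entries in a complex vector space by a
complex matrix `α`. -/
def matConj {V : Type*} [AddCommGroup V] [Module ℂ V] {ι κ : Type*} [Fintype κ]
    (α : Matrix ι κ ℂ) (A : Matrix κ κ V) : Matrix ι ι V :=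
  Matrix.of fun i j => ∑ k, ∑ l, (α i k * star (α j l)) • A k l

/-- An (abstract) operator system: a complex `*`-vector space `V` with a matrix ordering
(a compatible family of proper cones `cone n` in the hermitian part of `M_n(V)`) and an
Archimedean matrix order unit `unit`. The involution of `M_n(V)` is `Matrix.conjTranspose`. -/
class OperatorSystem (V : Type*) [AddCommGroup V] [Module ℂ V] [StarAddMonoid V]
    [StarModule ℂ V] where
  /-- The cone `M_n(V)⁺`. -/
  cone : (n : ℕ) → Set (Matrix (Fin n) (Fin n) V)
  /-- The unit `1_V`. -/
  unit : V
  isHermitian_of_mem : ∀ {n : ℕ} {A : Matrix (Fin n) (Fin n) V}, A ∈ cone n → A.IsHermitian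
  zero_mem : ∀ n : ℕ, (0 : Matrix (Fin n) (Fin n) V) ∈ cone n
  add_mem : ∀ {n : ℕ} {A B : Matrix (Fin n) (Fin n) V},
    A ∈ cone n → B ∈ cone n → A + B ∈ cone n
  /-- Compatibility of the cones; for `m = n` and `α = √r • 1` this gives closure under
  multiplication by real numbers `r ≥ 0`. -/
  conj_mem : ∀ {m n : ℕ} (α : Matrix (Fin m) (Fin n) ℂ) {A : Matrix (Fin n) (Fin n) V},
    A ∈ cone n → matConj α A ∈ cone m
  eq_zero_of_mem_of_neg_mem : ∀ {n : ℕ} {A : Matrix (Fin n) (Fin n) V},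
    A ∈ cone n → -A ∈ cone n → A = 0
  star_unit : star unit = unit
  exists_order_unit : ∀ {n : ℕ} {A : Matrix (Fin n) (Fin n) V}, A.IsHermitian →
    ∃ r : ℝ, 0 < r ∧ Matrix.diagonal (fun _ => (r : ℂ) • unit) + A ∈ cone n
  archimedean : ∀ {n : ℕ} {A : Matrix (Fin n) (Fin n) V}, A.IsHermitian →
    (∀ r : ℝ, 0 < r → Matrix.diagonal (fun _ => (r : ℂ) • unit) + A ∈ cone n) → A ∈ cone n

namespace OperatorSystem

/-- The order norm of an operator system:
`‖x‖ = inf {r ≥ 0 | [[r 1, x], [x*, r 1]] ∈ M_2(V)⁺}`. -/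
noncomputable def norm {V : Type*} [AddCommGroup V] [Module ℂ V] [StarAddMonoid V]
    [StarModule ℂ V] [OperatorSystem V] (x : V) : ℝ :=
  sInf {r : ℝ | 0 ≤ r ∧
    !![(r : ℂ) • (unit : V), x; star x, (r : ℂ) • (unit : V)] ∈ cone (V := V) 2}

end OperatorSystem

/-- Complete positivity of a linear map with respect to given families of cones in the
matrix spaces over its domain and codomain: all amplifications `[x_{ij}] ↦ [f(x_{ij})]`
preserve the cones. -/
def IsCompletelyPositive {V W : Type*} [AddCommGroup V] [Module ℂ V] [AddCommGroup W]
    [Module ℂ W] (C : (n : ℕ) → Set (Matrix (Fin n) (Fin n) V))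
    (D : (n : ℕ) → Set (Matrix (Fin n) (Fin n) W)) (f : V →ₗ[ℂ] W) : Prop :=
  ∀ (n : ℕ) (A : Matrix (Fin n) (Fin n) V), A ∈ C n → A.map f ∈ D n

/-- Unital completely positive maps between operator systems. -/
def IsUCP {V W : Type*} [AddCommGroup V] [Module ℂ V] [StarAddMonoid V] [StarModule ℂ V]
    [OperatorSystem V] [AddCommGroup W] [Module ℂ W] [StarAddMonoid W] [StarModule ℂ W]
    [OperatorSystem W] (f : V →ₗ[ℂ] W) : Prop :=
  f (OperatorSystem.unit : V) = (OperatorSystem.unit : W) ∧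
    IsCompletelyPositive (OperatorSystem.cone (V := V)) (OperatorSystem.cone (V := W)) f

section MatrixSystem

open scoped MatrixOrder Matrix.Norms.L2Operator in
theorem exists_posSemidef_add_of_isHermitian {ι : Type*} [Fintype ι] [DecidableEq ι]
    {A : Matrix ι ι ℂ} (hA : A.IsHermitian) :
    ∃ r : ℝ, 0 < r ∧ (Matrix.diagonal (fun _ : ι => (r : ℂ)) + A).PosSemidef := by
  have h0 : IsSelfAdjoint A := hA
  have h1 := h0.neg_algebraMap_norm_le_self
  refine ⟨‖A‖ + 1, by positivity, ?_⟩
  rw [← Matrix.nonneg_iff_posSemidef]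
  have h2 : (Matrix.diagonal (fun _ : ι => ((‖A‖ + 1 : ℝ) : ℂ)) : Matrix ι ι ℂ)
      = algebraMap ℝ (Matrix ι ι ℂ) ‖A‖ + 1 := by
    ext i j
    by_cases hij : i = j
    · subst hij; simp [Matrix.algebraMap_matrix_apply]
    · simp [Matrix.algebraMap_matrix_apply, hij]
  rw [h2]
  have h3 : (0 : Matrix ι ι ℂ) ≤ 1 := zero_le_one
  have h4 : (0 : Matrix ι ι ℂ) ≤ algebraMap ℝ (Matrix ι ι ℂ) ‖A‖ + A := by
    have := add_le_add_right h1 (algebraMap ℝ (Matrix ι ι ℂ) ‖A‖)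
    simpa using this
  have h5 := add_nonneg h4 h3
  rwa [show algebraMap ℝ (Matrix ι ι ℂ) ‖A‖ + 1 + A
    = algebraMap ℝ (Matrix ι ι ℂ) ‖A‖ + A + 1 by abel]

open scoped MatrixOrder in
theorem eq_zero_of_posSemidef_neg {ι : Type*} [Fintype ι] {A : Matrix ι ι ℂ}
    (h1 : A.PosSemidef) (h2 : (-A).PosSemidef) : A = 0 := by
  rw [← Matrix.nonneg_iff_posSemidef] at h1 h2
  exact le_antisymm (neg_nonneg.mp h2) h1

theorem posSemidef_of_forall_add {ι : Type*} [Fintype ι] [DecidableEq ι]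
    {A : Matrix ι ι ℂ} (hA : A.IsHermitian)
    (h : ∀ r : ℝ, 0 < r → (Matrix.diagonal (fun _ : ι => (r : ℂ)) + A).PosSemidef) :
    A.PosSemidef := by
  refine Matrix.PosSemidef.of_dotProduct_mulVec_nonneg hA fun x => ?_
  have hlim : Tendsto (fun r : ℝ => star x ⬝ᵥ
      ((Matrix.diagonal (fun _ : ι => (r : ℂ)) + A) *ᵥ x)) (𝓝[>] 0)
      (𝓝 (star x ⬝ᵥ (A *ᵥ x))) := by
    have hc : Continuous (fun r : ℝ => star x ⬝ᵥ
      ((Matrix.diagonal (fun _ : ι => (r : ℂ)) + A) *ᵥ x)) := by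
      fun_prop
    have := hc.tendsto 0
    simp only [Complex.ofReal_zero, Matrix.diagonal_zero, zero_add] at this
    exact this.mono_left nhdsWithin_le_nhds
  refine ge_of_tendsto hlim ?_
  filter_upwards [self_mem_nhdsWithin] with r hr
  exact (h r hr).dotProduct_mulVec_nonneg x

/-- The cone `M_k(M_N)⁺`: those `A` for which the complex matrix of size `kN` obtained by
erasing the inner brackets is positive semidefinite. -/
def matrixCone (N k : ℕ) : Set (Matrix (Fin k) (Fin k) (Matrix (Fin N) (Fin N) ℂ)) :=
  {A | (Matrix.comp (Fin k) (Fin k) (Fin N) (Fin N) ℂ A).PosSemidef}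

theorem comp_diagonal_smul_one (N k : ℕ) (r : ℂ) :
    Matrix.comp (Fin k) (Fin k) (Fin N) (Fin N) ℂ
      (Matrix.diagonal (fun _ => r • (1 : Matrix (Fin N) (Fin N) ℂ)))
      = Matrix.diagonal (fun _ => r) := by
  ext ⟨i, a⟩ ⟨j, b⟩
  by_cases hij : i = j
  · subst hij
    by_cases hab : a = b
    · subst hab; simp
    · simp [hab]
  · simp [hij]

theorem comp_matConj (N : ℕ) {m n : ℕ} (α : Matrix (Fin m) (Fin n) ℂ)
    (A : Matrix (Fin n) (Fin n) (Matrix (Fin N) (Fin N) ℂ)) :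
    Matrix.comp (Fin m) (Fin m) (Fin N) (Fin N) ℂ (matConj α A)
      = (α ⊗ₖ (1 : Matrix (Fin N) (Fin N) ℂ))
        * Matrix.comp (Fin n) (Fin n) (Fin N) (Fin N) ℂ A
        * (α ⊗ₖ (1 : Matrix (Fin N) (Fin N) ℂ))ᴴ := by
  ext ⟨i, a⟩ ⟨j, b⟩
  simp only [Matrix.comp_apply, matConj, Matrix.of_apply, Matrix.sum_apply, Matrix.smul_apply,
    Matrix.mul_apply, Fintype.sum_prod_type, Matrix.kroneckerMap_apply, Matrix.one_apply,
    Matrix.conjTranspose_apply]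
  simp [Finset.sum_mul, apply_ite (starRingEnd ℂ)]
  rw [Finset.sum_comm]
  refine Finset.sum_congr rfl fun l _ => Finset.sum_congr rfl fun k _ => ?_
  ring

/-- The complex matrices `M_N` as an operator system, with unit the identity matrix. -/
instance matrixOperatorSystem (N : ℕ) : OperatorSystem (Matrix (Fin N) (Fin N) ℂ) where
  cone := matrixCone N
  unit := 1
  isHermitian_of_mem := by
    intro n A hA
    have h := hA.1
    ext i j a b
    exact congrFun (congrFun h (i, a)) (j, b)
  zero_mem := fun n => Matrix.PosSemidef.zero
  add_mem := fun hA hB => Matrix.PosSemidef.add hA hB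
  conj_mem := by
    intro m n α A hA
    change Matrix.PosSemidef _
    rw [comp_matConj]
    exact Matrix.PosSemidef.mul_mul_conjTranspose_same hA _
  eq_zero_of_mem_of_neg_mem := by
    intro n A h1 h2
    have h := eq_zero_of_posSemidef_neg h1 h2
    ext i j a b
    exact congrFun (congrFun h (i, a)) (j, b)
  star_unit := star_one _
  exists_order_unit := by
    intro n A hA
    have h : (Matrix.comp (Fin n) (Fin n) (Fin N) (Fin N) ℂ A).IsHermitian := by
      ext ⟨i, a⟩ ⟨j, b⟩
      exact congrFun (congrFun (congrFun (congrFun hA i) j) a) b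
    obtain ⟨r, hr, h1⟩ := exists_posSemidef_add_of_isHermitian h
    refine ⟨r, hr, ?_⟩
    rw [← comp_diagonal_smul_one] at h1
    exact h1
  archimedean := by
    intro n A hA h
    have h0 : (Matrix.comp (Fin n) (Fin n) (Fin N) (Fin N) ℂ A).IsHermitian := by
      ext ⟨i, a⟩ ⟨j, b⟩
      exact congrFun (congrFun (congrFun (congrFun hA i) j) a) b
    refine posSemidef_of_forall_add h0 fun r hr => ?_
    rw [← comp_diagonal_smul_one]
    exact h r hr

end MatrixSystem

/-- The map `φ ⊗ ψ : V ⊗ W → M_k ⊗ M_m = M_{km}`. -/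
noncomputable def tensorToMatrix {V W : Type*} [AddCommGroup V] [Module ℂ V] [AddCommGroup W]
    [Module ℂ W] {k m : ℕ} (φ : V →ₗ[ℂ] Matrix (Fin k) (Fin k) ℂ)
    (ψ : W →ₗ[ℂ] Matrix (Fin m) (Fin m) ℂ) :
    V ⊗[ℂ] W →ₗ[ℂ] Matrix (Fin k × Fin m) (Fin k × Fin m) ℂ :=
  (kroneckerLinearEquiv (Fin k) (Fin k) (Fin m) (Fin m) ℂ).toLinearMap ∘ₗ
    TensorProduct.map φ ψ

section TensorCones

variable (V W : Type*) [AddCommGroup V] [Module ℂ V] [StarAddMonoid V] [StarModule ℂ V]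
  [OperatorSystem V] [AddCommGroup W] [Module ℂ W] [StarAddMonoid W] [StarModule ℂ W]
  [OperatorSystem W]

/-- The cones `M_n(V ⊗_min W)⁺` of the minimal tensor product: `[p_{ij}]` is positive iff
`[(φ ⊗ ψ)(p_{ij})]` is positive semidefinite for all unital completely positive
`φ : V → M_k` and `ψ : W → M_m`. -/
def minCone (n : ℕ) : Set (Matrix (Fin n) (Fin n) (V ⊗[ℂ] W)) :=
  {p | ∀ (k m : ℕ) (φ : V →ₗ[ℂ] Matrix (Fin k) (Fin k) ℂ)
      (ψ : W →ₗ[ℂ] Matrix (Fin m) (Fin m) ℂ), IsUCP φ → IsUCP ψ →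
      (Matrix.comp (Fin n) (Fin n) (Fin k × Fin m) (Fin k × Fin m) ℂ
        (p.map (tensorToMatrix φ ψ))).PosSemidef}

/-- The matrix ordering `D_n^max(V, W) = {α (P ⊗ Q) α*}`. -/
def maxPreCone (n : ℕ) : Set (Matrix (Fin n) (Fin n) (V ⊗[ℂ] W)) :=
  {X | ∃ (k l : ℕ) (P : Matrix (Fin k) (Fin k) V) (Q : Matrix (Fin l) (Fin l) W)
      (α : Matrix (Fin n) (Fin k × Fin l) ℂ),
      P ∈ OperatorSystem.cone k ∧ Q ∈ OperatorSystem.cone l ∧ X = matConj α (P ⊗ₖₜ[ℂ] Q)}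

/-- The cones `M_n(V ⊗_max W)⁺` of the maximal tensor product: the Archimedeanization of
the matrix ordering `maxPreCone`. -/
def maxCone (n : ℕ) : Set (Matrix (Fin n) (Fin n) (V ⊗[ℂ] W)) :=
  {X | ∀ ε : ℝ, 0 < ε →
      X + Matrix.diagonal (fun _ => (ε : ℂ) •
        ((OperatorSystem.unit : V) ⊗ₜ[ℂ] (OperatorSystem.unit : W))) ∈ maxPreCone V W n}

end TensorCones

/-! Condition (iii) is first reduced to `ApproximatelyFactors`: on each finite set and up to each
tolerance, Φ agrees with a composite of ucp maps through some M_N.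

From (iii) to (i). If Φ = ψφ exactly, with φ into M_N, then for X in the minimal cone the matrix Y =
(id ⊗ φ)(X) may be read as a matrix of size nN over R. It is positive because ucp maps into matrix
algebras determine the cones of R (`pos_of_forall_isUCP`). Contracting Y ⊗ [ψ(e_ab)] gives (id ⊗
ψφ)(X), and [ψ(e_ab)] is positive, so the result lies in the maximal pre-cone
(`map_mem_maxPreCone`). For an approximate factorization, X is a finite sum of terms a ⊗ B with a
and B hermitian. The error terms a ⊗ (Φ − ψφ)(B) are dominated by a small multiple of the unit,
which the ε in the maximal cone absorbs.

From (ii) to (iii). Let E be the operator subsystem of S generated by a finite set. The dual E* is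
again an operator system (`dualOperatorSystem`), and the inclusion E → S is a positive element of E*
⊗_min S (`tensorOfMap_mem_minCone`). By (ii), its image plus ε times the unit has the form α(P ⊗
Q)α*. Here P is a cp map from E to matrices. It extends to S (`PairingNonneg.exists_extension`) and
is a compression of a ucp map (`PairingNonneg.exists_isUCP`), while Q gives a cp map from matrices
to T (`choiMap`). So Φ + εf(·)1 factors on E, where f is the unit of E*. Dividing by its value at 1
makes the second map unital at a cost of order ε.

The extension and separation results rest on one fact: a cp map V → M_n is the same as a positive
functional on M_n(V). This reduces them to the Riesz extension theorem. -/

theorem sum_sum_comm {M ι κ μ ν : Type*} [AddCommMonoid M] [Fintype ι] [Fintype κ] [Fintype μ]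
    [Fintype ν] (f : ι → κ → μ → ν → M) :
    ∑ i, ∑ k, ∑ m, ∑ n, f i k m n = ∑ m, ∑ n, ∑ i, ∑ k, f i k m n := by
  have h := Finset.sum_comm (s := (Finset.univ : Finset (ι × κ)))
    (t := (Finset.univ : Finset (μ × ν))) (f := fun p q => f p.1 p.2 q.1 q.2)
  simpa only [Fintype.sum_prod_type] using h

/-! ### Algebra of the compressions αAα*. -/

section MatConj

variable {V W : Type*} [AddCommGroup V] [Module ℂ V] [AddCommGroup W] [Module ℂ W]
  {ι κ μ : Type*} [Fintype κ] [Fintype μ]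

theorem matConj_apply (α : Matrix ι κ ℂ) (A : Matrix κ κ V) (i j : ι) :
    matConj α A i j = ∑ k, ∑ l, (α i k * star (α j l)) • A k l := rfl

theorem matConj_matConj (α : Matrix ι κ ℂ) (β : Matrix κ μ ℂ) (A : Matrix μ μ V) :
    matConj α (matConj β A) = matConj (α * β) A := by
  ext i j
  simp only [matConj_apply, Matrix.mul_apply, star_sum, Finset.sum_mul_sum, Finset.smul_sum,
    Finset.sum_smul, smul_smul, star_mul']
  rw [sum_sum_comm]
  refine Finset.sum_congr rfl fun x _ => Finset.sum_congr rfl fun y _ =>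
    Finset.sum_congr rfl fun k _ => Finset.sum_congr rfl fun l _ => ?_
  congr 1
  ring

theorem matConj_submatrix_one [DecidableEq κ] (f : ι → κ) (A : Matrix κ κ V) :
    matConj ((1 : Matrix κ κ ℂ).submatrix f id) A = A.submatrix f f := by
  ext i j
  simp [matConj_apply, Matrix.one_apply, apply_ite (starRingEnd ℂ), ite_smul]

theorem matConj_one [DecidableEq κ] (A : Matrix κ κ V) : matConj (1 : Matrix κ κ ℂ) A = A :=
  matConj_submatrix_one id A

theorem matConj_zero (α : Matrix ι κ ℂ) : matConj α (0 : Matrix κ κ V) = 0 := by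
  ext i j
  simp [matConj_apply]

theorem matConj_add (α : Matrix ι κ ℂ) (A B : Matrix κ κ V) :
    matConj α (A + B) = matConj α A + matConj α B := by
  ext i j
  simp [matConj_apply, Finset.sum_add_distrib]

theorem matConj_smul (α : Matrix ι κ ℂ) (r : ℂ) (A : Matrix κ κ V) :
    matConj α (r • A) = r • matConj α A := by
  ext i j
  simp only [matConj_apply, Matrix.smul_apply, Finset.smul_sum, smul_comm r]

theorem matConj_map (f : V →ₗ[ℂ] W) (α : Matrix ι κ ℂ) (A : Matrix κ κ V) :
    (matConj α A).map f = matConj α (A.map f) := by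
  ext i j
  simp [matConj_apply]

theorem matConj_smul_one [DecidableEq κ] (r : ℂ) (A : Matrix κ κ V) :
    matConj (r • (1 : Matrix κ κ ℂ)) A = (r * star r) • A := by
  ext i j
  simp [matConj_apply, Matrix.one_apply, apply_ite (starRingEnd ℂ), ite_smul, mul_comm]

end MatConj

namespace OperatorSystem

/-! ### Positivity of matrices indexed by arbitrary finite types. -/

section Pos

variable {V : Type*} [AddCommGroup V] [Module ℂ V] [StarAddMonoid V] [StarModule ℂ V]
  [OperatorSystem V] {ι κ : Type*} [Fintype ι] [Fintype κ]

/-- Positivity of a matrix over an operator system, for an arbitrary finite index type. -/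
def Pos (A : Matrix ι ι V) : Prop :=
  ∀ (n : ℕ) (α : Matrix (Fin n) ι ℂ), _root_.matConj α A ∈ cone (V := V) n

theorem pos_iff_mem {n : ℕ} {A : Matrix (Fin n) (Fin n) V} : Pos A ↔ A ∈ cone (V := V) n :=
  ⟨fun h => by simpa only [matConj_one] using h n 1, fun h _ α => conj_mem α h⟩

theorem Pos.matConj {A : Matrix ι ι V} (h : Pos A) (α : Matrix κ ι ℂ) :
    Pos (matConj α A) := fun n β => by
  rw [matConj_matConj]
  exact h n _

theorem Pos.submatrix {A : Matrix ι ι V} (h : Pos A) (f : κ → ι) : Pos (A.submatrix f f) := by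
  classical
  rw [← matConj_submatrix_one]
  exact h.matConj _

theorem pos_submatrix_equiv (e : κ ≃ ι) {A : Matrix ι ι V} : Pos (A.submatrix e e) ↔ Pos A :=
  ⟨fun h => by simpa using h.submatrix e.symm, fun h => h.submatrix e⟩

theorem pos_iff_mem_card {A : Matrix ι ι V} :
    Pos A ↔ A.submatrix (Fintype.equivFin ι).symm (Fintype.equivFin ι).symm ∈
      cone (V := V) (Fintype.card ι) := by
  rw [← pos_iff_mem, pos_submatrix_equiv]

theorem pos_zero : Pos (0 : Matrix ι ι V) := fun n α => by
  rw [matConj_zero]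
  exact zero_mem n

theorem Pos.add {A B : Matrix ι ι V} (hA : Pos A) (hB : Pos B) : Pos (A + B) := fun n α => by
  rw [matConj_add]
  exact add_mem (hA n α) (hB n α)

theorem pos_sum {σ : Type*} (s : Finset σ) {A : σ → Matrix ι ι V} (h : ∀ x ∈ s, Pos (A x)) :
    Pos (∑ x ∈ s, A x) :=
  Finset.sum_induction A Pos (fun _ _ => Pos.add) pos_zero h

theorem Pos.smul {A : Matrix ι ι V} (hA : Pos A) {r : ℝ} (hr : 0 ≤ r) : Pos ((r : ℂ) • A) := by
  classical
  have h := hA.matConj ((√r : ℂ) • (1 : Matrix ι ι ℂ))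
  rwa [matConj_smul_one, Complex.star_def, Complex.conj_ofReal, ← Complex.ofReal_mul,
    Real.mul_self_sqrt hr] at h

theorem Pos.isHermitian {A : Matrix ι ι V} (hA : Pos A) : A.IsHermitian := by
  have h := (isHermitian_of_mem (pos_iff_mem_card.1 hA)).submatrix (Fintype.equivFin ι)
  simpa using h

theorem Pos.eq_zero {A : Matrix ι ι V} (hA : Pos A) (hA' : Pos (-A)) : A = 0 := by
  have h := eq_zero_of_mem_of_neg_mem (pos_iff_mem_card.1 hA) (pos_iff_mem_card.1 hA')
  simpa using congrArg (fun B => B.submatrix (Fintype.equivFin ι) (Fintype.equivFin ι)) h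

omit [Fintype ι] in
variable (V ι) in
/-- The unit of `M_ι(V)`. -/
def matUnit [DecidableEq ι] : Matrix ι ι V := Matrix.diagonal fun _ => unit

omit [Fintype ι] in
theorem smul_matUnit [DecidableEq ι] (r : ℂ) :
    r • matUnit V ι = Matrix.diagonal fun _ => r • unit :=
  (Matrix.diagonal_smul r _).symm

omit [Fintype ι] [Fintype κ] in
theorem matUnit_submatrix [DecidableEq ι] [DecidableEq κ] (e : κ ≃ ι) :
    (matUnit V ι).submatrix e e = matUnit V κ := by
  ext i j
  simp [matUnit, Matrix.diagonal_apply]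

theorem exists_pos_add [DecidableEq ι] {A : Matrix ι ι V} (hA : A.IsHermitian) :
    ∃ r : ℝ, 0 < r ∧ Pos ((r : ℂ) • matUnit V ι + A) := by
  obtain ⟨r, hr, h⟩ := exists_order_unit (hA.submatrix (Fintype.equivFin ι).symm)
  refine ⟨r, hr, pos_iff_mem_card.2 ?_⟩
  rwa [Matrix.submatrix_add, Pi.add_apply, Pi.add_apply, Matrix.submatrix_smul, Pi.smul_apply,
    Pi.smul_apply, matUnit_submatrix, smul_matUnit]

theorem pos_of_forall_add [DecidableEq ι] {A : Matrix ι ι V} (hA : A.IsHermitian)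
    (h : ∀ r : ℝ, 0 < r → Pos ((r : ℂ) • matUnit V ι + A)) : Pos A := by
  refine pos_iff_mem_card.2 (archimedean (hA.submatrix _) fun r hr => ?_)
  have := pos_iff_mem_card.1 (h r hr)
  rwa [Matrix.submatrix_add, Pi.add_apply, Pi.add_apply, Matrix.submatrix_smul, Pi.smul_apply,
    Pi.smul_apply, matUnit_submatrix, smul_matUnit] at this

theorem pos_matUnit [DecidableEq ι] : Pos (matUnit V ι) := by
  obtain ⟨r, hr, h⟩ := exists_pos_add (ι := ι) (V := V) Matrix.isHermitian_zero
  rw [add_zero] at h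
  have := h.smul (inv_nonneg.2 hr.le)
  rwa [smul_smul, ← Complex.ofReal_mul, inv_mul_cancel₀ hr.ne', Complex.ofReal_one,
    one_smul] at this

end Pos

end OperatorSystem

/-! ### Extension of positive functionals and separation by states. -/

section PositiveFunctionals

variable {W : Type*} [AddCommGroup W] [Module ℂ W] [StarAddMonoid W] [StarModule ℂ W]

/-- A complex `*`-vector space with a convex cone of hermitian elements and an order unit. -/
structure IsOrderUnitCone (C : Set W) (e : W) : Prop where
  star_eq : ∀ {x}, x ∈ C → star x = x
  zero_mem : 0 ∈ C
  add_mem : ∀ {x y}, x ∈ C → y ∈ C → x + y ∈ C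
  smul_mem : ∀ {r : ℝ} {x}, 0 ≤ r → x ∈ C → (r : ℂ) • x ∈ C
  unit_mem : e ∈ C
  order_unit : ∀ {x}, star x = x → ∃ r : ℝ, (r : ℂ) • e + x ∈ C

variable {C : Set W} {e : W}

/-- A hermitian y is the difference of the cone elements re + y and re, on both of which g is real.
The general case follows by splitting x into real and imaginary parts. -/
theorem IsOrderUnitCone.map_star (hC : IsOrderUnitCone C e) {M : Submodule ℂ W} (he : e ∈ M)
    (hM : ∀ x ∈ M, star x ∈ M) (g : M →ₗ[ℂ] ℂ) (hg : ∀ x : M, (x : W) ∈ C → 0 ≤ g x) (x : M) :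
    g ⟨star x, hM x x.2⟩ = star (g x) := by
  have key : ∀ y : M, star (y : W) = y → star (g y) = g y := fun y hy => by
    obtain ⟨r, hr⟩ := hC.order_unit hy
    have h1 := hg ((r : ℂ) • ⟨e, he⟩ + y) hr
    have h2 := hg ⟨e, he⟩ hC.unit_mem
    rw [map_add, map_smul, smul_eq_mul] at h1
    have h3 := (Complex.nonneg_iff.1 h1).2
    have h4 := (Complex.nonneg_iff.1 h2).2
    rw [Complex.star_def, Complex.conj_eq_iff_im]
    simp [← h4] at h3
    exact h3.symm
  set y : M := ⟨star x, hM x x.2⟩ with hy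
  have h1 := key (x + y) (by simp [hy, add_comm])
  have h2 := key (Complex.I • (x - y)) (by
    simp [hy, star_smul, smul_sub, neg_add_eq_sub])
  simp only [map_add, map_smul, map_sub, smul_eq_mul, star_add, star_mul', star_sub,
    Complex.star_def, Complex.conj_I] at h1 h2
  have h3 : star (g x) - star (g y) = g y - g x := by
    apply mul_left_cancel₀ Complex.I_ne_zero
    simp only [Complex.star_def]
    linear_combination -h2
  simp only [Complex.star_def] at h3 ⊢
  linear_combination (-1 / 2 : ℂ) * h1 - (1 / 2 : ℂ) * h3

/-- A positive functional on a self-adjoint subspace containing the order unit extends to a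
positive functional. -/
theorem IsOrderUnitCone.exists_extension (hC : IsOrderUnitCone C e) (M : Submodule ℂ W)
    (he : e ∈ M) (hM : ∀ x ∈ M, star x ∈ M) (g₀ : M →ₗ[ℂ] ℂ)
    (hg₀ : ∀ x : M, (x : W) ∈ C → 0 ≤ g₀ x) :
    ∃ g : W →ₗ[ℂ] ℂ, (∀ x : M, g x = g₀ x) ∧ ∀ x ∈ C, 0 ≤ g x := by
  -- The Riesz theorem is applied over ℝ to the cone of elements whose real part lies in C. This
  -- cone contains all skew elements, so adding M to it fills W, not only the hermitian part.
  let s : PointedCone ℝ W :=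
    { carrier := {x | x + star x ∈ C}
      add_mem' := fun {a b} ha hb => by
        have := hC.add_mem ha hb
        change a + b + star (a + b) ∈ C
        rwa [star_add, add_add_add_comm]
      zero_mem' := by
        change 0 + star 0 ∈ C
        simpa using hC.zero_mem
      smul_mem' := fun r x hx => by
        have := hC.smul_mem r.2 hx
        change (r : ℝ) • x + star ((r : ℝ) • x) ∈ C
        rw [← Complex.coe_smul, star_smul, Complex.star_def, Complex.conj_ofReal, ← smul_add]
        exact this }
  have hs : ∀ x, x ∈ s ↔ x + star x ∈ C := fun x => Iff.rfl
  let f : W →ₗ.[ℝ] ℝ :=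
    { domain := M.restrictScalars ℝ
      toFun := Complex.reLm ∘ₗ g₀.restrictScalars ℝ }
  have hf : ∀ (x : M), f ⟨x, x.2⟩ = (g₀ x).re := fun x => rfl
  obtain ⟨g, hg, hgs⟩ := riesz_extension s f (fun x hx => by
    have h1 := hg₀ ((⟨x, x.2⟩ : M) + ⟨star x, hM x x.2⟩) (show (x : W) + star (x : W) ∈ C from hx)
    rw [map_add, hC.map_star he hM g₀ hg₀ ⟨x, x.2⟩] at h1
    have h2 := (Complex.nonneg_iff.1 h1).1
    simp at h2
    exact h2) (fun y => by
    obtain ⟨r, hr⟩ := hC.order_unit (x := y + star y) (by simp [add_comm])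
    -- Membership in `s` adds an element to its adjoint, which doubles the multiple of e; hence r /
    -- 2.
    refine ⟨⟨((r / 2 : ℝ) : ℂ) • e, M.smul_mem _ he⟩, ?_⟩
    rw [hs]
    rw [star_add, star_smul, hC.star_eq hC.unit_mem, Complex.star_def, Complex.conj_ofReal,
      add_add_add_comm, ← add_smul, ← Complex.ofReal_add, add_halves]
    exact hr)
  -- Both ix and −ix have zero real part, so both lie in `s`. Hence the complexification of g is
  -- real on C.
  have key : ∀ x ∈ C, g (Complex.I • x) = 0 := fun x hx => by
    have h1 := hgs (Complex.I • x) (by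
      rw [hs, star_smul, hC.star_eq hx]; simpa [Complex.star_def] using hC.zero_mem)
    have h2 := hgs (-(Complex.I • x)) (by
      rw [hs, star_neg, star_smul, hC.star_eq hx]; simpa [Complex.star_def] using hC.zero_mem)
    rw [map_neg] at h2
    linarith
  refine ⟨Module.Dual.extendRCLike g, fun x => ?_, fun x hx => ?_⟩
  · have h1 := hg ⟨x, x.2⟩
    have h2 := hg ⟨(Complex.I • x : M), (Complex.I • x).2⟩
    rw [hf] at h1 h2
    rw [Module.Dual.extendRCLike_apply]
    rw [map_smul] at h2
    change g (x : W) = _ at h1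
    change g (Complex.I • (x : W)) = _ at h2
    apply Complex.ext
    · simp [h1]
    · simp [h2]
  · rw [Module.Dual.extendRCLike_apply]
    have := hgs x (by
      rw [hs, hC.star_eq hx]
      exact hC.add_mem hx hx)
    simp [key x hx, this]

theorem IsOrderUnitCone.map_star_of_nonneg (hC : IsOrderUnitCone C e) {g : W →ₗ[ℂ] ℂ}
    (hg : ∀ x ∈ C, 0 ≤ g x) (x : W) : g (star x) = star (g x) :=
  hC.map_star (M := ⊤) trivial (fun _ _ => trivial) (g.domRestrict ⊤) (fun x => hg x) ⟨x, trivial⟩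

/-- A complex `*`-vector space with a proper cone and an Archimedean order unit. -/
structure IsArchimedeanCone (C : Set W) (e : W) : Prop extends IsOrderUnitCone C e where
  eq_zero : ∀ {x}, x ∈ C → -x ∈ C → x = 0
  archimedean : ∀ {x}, star x = x → (∀ r : ℝ, 0 < r → (r : ℂ) • e + x ∈ C) → x ∈ C

/-- States separate the points outside an Archimedean cone from the cone. -/
theorem IsArchimedeanCone.exists_state_neg (hC : IsArchimedeanCone C e) {a : W}
    (ha : star a = a) (haC : a ∉ C) :
    ∃ g : W →ₗ[ℂ] ℂ, (∀ x ∈ C, 0 ≤ g x) ∧ g e = 1 ∧ (g a).re < 0 := by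
  obtain ⟨r, hr, hra⟩ : ∃ r : ℝ, 0 < r ∧ (r : ℂ) • e + a ∉ C := by
    by_contra! h
    exact haC (hC.archimedean ha h)
  have he : e ≠ 0 := by
    rintro rfl
    exact haC (hC.archimedean ha fun r _ => by
      obtain ⟨t, ht⟩ := hC.order_unit ha
      simpa using ht)
  set b := (r : ℂ) • e + a with hb
  have hbs : star b = b := by
    rw [hb, star_add, star_smul, ha, hC.star_eq hC.unit_mem, Complex.star_def,
      Complex.conj_ofReal]
  -- Adjoin −b to the cone. No negative multiple of e enters D, since that would put b or −e into C.
  -- So e ↦ 1 is positive on the span of e and extends with g(b) ≤ 0, that is g(a) ≤ −r < 0.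
  let D : Set W := {x | ∃ p ∈ C, ∃ t : ℝ, 0 ≤ t ∧ x = p - (t : ℂ) • b}
  have hCD : C ⊆ D := fun x hx => ⟨x, hx, 0, le_rfl, by simp⟩
  have hD : IsOrderUnitCone D e :=
    { star_eq := by
        rintro _ ⟨p, hp, t, -, rfl⟩
        rw [star_sub, star_smul, hC.star_eq hp, hbs, Complex.star_def, Complex.conj_ofReal]
      zero_mem := hCD hC.zero_mem
      add_mem := by
        rintro _ _ ⟨p, hp, t, ht, rfl⟩ ⟨q, hq, u, hu, rfl⟩
        refine ⟨p + q, hC.add_mem hp hq, t + u, add_nonneg ht hu, ?_⟩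
        push_cast
        module
      smul_mem := by
        rintro c _ hc ⟨p, hp, t, ht, rfl⟩
        refine ⟨(c : ℂ) • p, hC.smul_mem hc hp, c * t, mul_nonneg hc ht, ?_⟩
        push_cast
        module
      unit_mem := hCD hC.unit_mem
      order_unit := fun hx => (hC.order_unit hx).imp fun _ h => hCD h }
  obtain ⟨g, hg, hgD⟩ := hD.exists_extension (Submodule.span ℂ {e})
    (Submodule.mem_span_singleton_self e) (fun x hx => by
      obtain ⟨c, rfl⟩ := Submodule.mem_span_singleton.1 hx
      rw [star_smul, hC.star_eq hC.unit_mem]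
      exact Submodule.smul_mem _ _ (Submodule.mem_span_singleton_self e))
    (LinearEquiv.toSpanNonzeroSingleton ℂ W e he).symm.toLinearMap (by
      intro x hx
      obtain ⟨c, rfl⟩ := (LinearEquiv.toSpanNonzeroSingleton ℂ W e he).surjective x
      rw [LinearEquiv.coe_coe, LinearEquiv.symm_apply_apply]
      rw [LinearEquiv.toSpanNonzeroSingleton_apply] at hx
      change c • e ∈ D at hx
      have hc : star c = c := by
        have := hD.star_eq hx
        rw [star_smul, hC.star_eq hC.unit_mem] at this
        exact smul_left_injective ℂ he this
      obtain ⟨c, rfl⟩ := Complex.conj_eq_iff_real.1 hc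
      by_contra hneg
      have hc0 : c < 0 := by
        rw [not_le.symm]
        exact fun h => hneg (Complex.zero_le_real.2 h)
      obtain ⟨p, hp, t, ht, h⟩ := hx
      have h1 : (t : ℂ) • b = p + ((-c : ℝ) : ℂ) • e := by
        rw [Complex.ofReal_neg, neg_smul, h]
        abel
      have h2 : (t : ℂ) • b ∈ C := by
        rw [h1]
        exact hC.add_mem hp (hC.smul_mem (neg_nonneg.2 hc0.le) hC.unit_mem)
      rcases ht.eq_or_lt with rfl | ht
      · rw [Complex.ofReal_zero, zero_smul] at h1
        have hc := hC.smul_mem (neg_nonneg.2 hc0.le) hC.unit_mem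
        have h0 := hC.eq_zero hc (by rwa [← eq_neg_of_add_eq_zero_left h1.symm])
        exact (smul_ne_zero (Complex.ofReal_ne_zero.2 (neg_ne_zero.2 hc0.ne)) he) h0
      · apply hra
        have := hC.smul_mem (inv_nonneg.2 ht.le) h2
        rwa [smul_smul, ← Complex.ofReal_mul, inv_mul_cancel₀ ht.ne', Complex.ofReal_one,
          one_smul] at this)
  have hge : g e = 1 := by
    rw [hg ⟨e, Submodule.mem_span_singleton_self e⟩, LinearEquiv.coe_coe,
      LinearEquiv.symm_apply_eq]
    ext
    simp
  refine ⟨g, fun x hx => hgD x (hCD hx), hge, ?_⟩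
  have h1 := hgD (-b) ⟨0, hC.zero_mem, 1, zero_le_one, by simp⟩
  rw [hb, map_neg, map_add, map_smul, hge] at h1
  have h2 := (Complex.nonneg_iff.1 h1).1
  simp at h2
  linarith

/-- Hermitian a is covered by separation. In general every state is real at a, so it kills the
hermitian element i(a − a*); that element and its negative then lie in C, which forces a = a*. -/
theorem IsArchimedeanCone.mem_of_forall_state (hC : IsArchimedeanCone C e) {a : W}
    (h : ∀ g : W →ₗ[ℂ] ℂ, (∀ x ∈ C, 0 ≤ g x) → g e = 1 → 0 ≤ g a) : a ∈ C := by
  have key : ∀ b : W, star b = b →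
      (∀ g : W →ₗ[ℂ] ℂ, (∀ x ∈ C, 0 ≤ g x) → g e = 1 → 0 ≤ g b) → b ∈ C := fun b hb hgb => by
    by_contra hbC
    obtain ⟨g, hg, hge, hneg⟩ := hC.exists_state_neg hb hbC
    exact hneg.not_ge (Complex.nonneg_iff.1 (hgb g hg hge)).1
  have hstar : ∀ g : W →ₗ[ℂ] ℂ, (∀ x ∈ C, 0 ≤ g x) → g e = 1 →
      g (Complex.I • (a - star a)) = 0 := fun g hg hge => by
    rw [map_smul, map_sub, hC.map_star_of_nonneg hg, Complex.star_def,
      Complex.conj_eq_iff_im.2 (Complex.nonneg_iff.1 (h g hg hge)).2.symm, sub_self, smul_zero]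
  have hI : star (Complex.I • (a - star a)) = Complex.I • (a - star a) := by
    rw [star_smul, star_sub, star_star, Complex.star_def, Complex.conj_I, neg_smul, ← smul_neg,
      neg_sub]
  have h0 := hC.eq_zero (key _ hI fun g hg hge => (hstar g hg hge).ge)
    (key (-_) (by rw [star_neg, hI]) fun g hg hge => by
      rw [map_neg, hstar g hg hge, neg_zero])
  refine key a ?_ h
  rw [smul_eq_zero_iff_right Complex.I_ne_zero, sub_eq_zero] at h0
  exact h0.symm

theorem IsArchimedeanCone.eq_zero_of_forall_state (hC : IsArchimedeanCone C e) {a : W}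
    (h : ∀ g : W →ₗ[ℂ] ℂ, (∀ x ∈ C, 0 ≤ g x) → g e = 1 → g a = 0) : a = 0 :=
  hC.eq_zero (hC.mem_of_forall_state fun g hg hge => (h g hg hge).ge)
    (hC.mem_of_forall_state fun g hg hge => by rw [map_neg, h g hg hge, neg_zero])

end PositiveFunctionals

/-- A positive semidefinite matrix `B` is invertible on its support: there are `β`, `γ` with
`γ B γ* = 1` such that `β γ` is a projection with the same kernel as `B`. -/
theorem Matrix.PosSemidef.exists_support {ι : Type*} [Fintype ι] [DecidableEq ι]
    {B : Matrix ι ι ℂ} (hB : B.PosSemidef) :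
    ∃ (m : ℕ) (β : Matrix ι (Fin m) ℂ) (γ : Matrix (Fin m) ι ℂ), γ * B * γᴴ = 1 ∧
      ∀ X : Matrix ι ι ℂ, (∀ x, B *ᵥ x = 0 → X *ᵥ x = 0) → X * (γᴴ * βᴴ) = X := by
  classical
  set d := hB.1.eigenvalues with hd
  have hd0 : ∀ i, 0 ≤ d i := hB.eigenvalues_nonneg
  let U : Matrix ι ι ℂ := hB.1.eigenvectorUnitary
  have hUU : Uᴴ * U = 1 := Unitary.coe_star_mul_self hB.1.eigenvectorUnitary
  have hUU' : U * Uᴴ = 1 := Unitary.coe_mul_star_self hB.1.eigenvectorUnitary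
  have hBU : B * U = U * Matrix.diagonal (fun i => (d i : ℂ)) := by
    ext a i
    have := congrFun (hB.1.mulVec_eigenvectorBasis i) a
    rw [Matrix.mul_diagonal]
    simp only [Pi.smul_apply, Complex.real_smul] at this
    rw [mul_comm]
    simpa [U, Matrix.mul_apply, Matrix.mulVec, dotProduct] using this
  let e : Fin (Fintype.card {i // d i ≠ 0}) ≃ {i // d i ≠ 0} := (Fintype.equivFin _).symm
  let U' : Matrix ι (Fin (Fintype.card {i // d i ≠ 0})) ℂ := U.submatrix id fun s => (e s).1
  have hds : ∀ s, (√(d (e s).1) : ℂ) ≠ 0 := fun s =>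
    Complex.ofReal_ne_zero.2 (Real.sqrt_ne_zero'.2 ((hd0 _).lt_of_ne' (e s).2))
  let Δ : Matrix (Fin (Fintype.card {i // d i ≠ 0})) (Fin (Fintype.card {i // d i ≠ 0})) ℂ :=
    Matrix.diagonal fun s => (√(d (e s).1) : ℂ)
  let Δ' : Matrix (Fin (Fintype.card {i // d i ≠ 0})) (Fin (Fintype.card {i // d i ≠ 0})) ℂ :=
    Matrix.diagonal fun s => (√(d (e s).1) : ℂ)⁻¹
  have hΔ : Δᴴ = Δ := by
    simp only [Δ, Matrix.diagonal_conjTranspose]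
    congr 1; ext s; simp
  have hΔ' : Δ'ᴴ = Δ' := by
    simp only [Δ', Matrix.diagonal_conjTranspose]
    congr 1; ext s; simp
  have hΔΔ : Δ' * Δ = 1 := by
    simp only [Δ, Δ', Matrix.diagonal_mul_diagonal, inv_mul_cancel₀ (hds _), Matrix.diagonal_one]
  have hΔd : Δ' * Matrix.diagonal (fun s => (d (e s).1 : ℂ)) * Δ' = 1 := by
    simp only [Δ', Matrix.diagonal_mul_diagonal]
    rw [← Matrix.diagonal_one]
    congr 1; ext s
    rw [inv_mul_eq_div, ← div_eq_mul_inv, div_div, ← Complex.ofReal_mul,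
      Real.mul_self_sqrt (hd0 _), div_self (Complex.ofReal_ne_zero.2 (e s).2)]
  have hU' : U'ᴴ * B * U' = Matrix.diagonal (fun s => (d (e s).1 : ℂ)) := by
    have h : U'ᴴ * B * U' = (Uᴴ * (B * U)).submatrix (fun s => (e s).1) (fun s => (e s).1) := by
      rw [Matrix.mul_assoc]
      ext s t
      simp [U', Matrix.mul_apply]
    rw [h, hBU, ← Matrix.mul_assoc, hUU, Matrix.one_mul]
    ext s t
    simp [Matrix.diagonal_apply, Subtype.val_inj]
  -- U' keeps the eigenvectors with nonzero eigenvalue and Δ holds the square roots of those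
  -- eigenvalues. Then γ*β* = U'U'* is the projection onto the support of B. The size is 0 when B =
  -- 0.
  refine ⟨_, U' * Δ, Δ' * U'ᴴ, ?_, fun X hX => ?_⟩
  · rw [Matrix.conjTranspose_mul, Matrix.conjTranspose_conjTranspose, hΔ',
      show Δ' * U'ᴴ * B * (U' * Δ') = Δ' * (U'ᴴ * B * U') * Δ' by simp only [Matrix.mul_assoc],
      hU', hΔd]
  · rw [Matrix.conjTranspose_mul, Matrix.conjTranspose_conjTranspose, Matrix.conjTranspose_mul,
      hΔ, hΔ', show U' * Δ' * (Δ * U'ᴴ) = U' * (Δ' * Δ) * U'ᴴ by simp only [Matrix.mul_assoc],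
      hΔΔ, Matrix.mul_one]
    have h0 : ∀ i, d i = 0 → ∀ a, (X * U) a i = 0 := fun i hi a => by
      have h1 : B *ᵥ (fun b => U b i) = 0 := by
        ext b
        have := congrFun (congrFun hBU b) i
        rw [Matrix.mul_diagonal, hi, Complex.ofReal_zero, mul_zero] at this
        exact this
      exact congrFun (hX _ h1) a
    conv_rhs => rw [← Matrix.mul_one X, ← hUU', ← Matrix.mul_assoc]
    rw [← Matrix.mul_assoc]
    ext a b
    have h2 : ∀ f : ι → ℂ, (∀ i, d i = 0 → f i = 0) → ∑ s, f (e s).1 = ∑ i, f i := fun f hf => by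
      rw [e.sum_comp (fun i => f i.1),
        ← Fintype.sum_subtype_add_sum_subtype (fun i => d i ≠ 0) f, eq_comm, add_eq_left]
      exact Finset.sum_eq_zero fun i _ => hf _ (not_not.1 i.2)
    exact h2 (fun i => (X * U) a i * Uᴴ i b) fun i hi => by rw [h0 i hi a, zero_mul]

namespace OperatorSystem

/-! ### Completely positive maps V → M_n as positive functionals on M_n(V). -/

section Pairing

variable {V : Type*} [AddCommGroup V] [Module ℂ V] {ι κ : Type*} [Fintype ι] [Fintype κ]

/-- The linear functional on `M_ι(V)` associated with a linear map `V → M_ι`. -/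
def pairing (φ : V →ₗ[ℂ] Matrix ι ι ℂ) : Matrix ι ι V →ₗ[ℂ] ℂ where
  toFun A := ∑ i, ∑ j, φ (A i j) i j
  map_add' A B := by simp [Finset.sum_add_distrib]
  map_smul' r A := by simp [Finset.mul_sum]

theorem pairing_apply (φ : V →ₗ[ℂ] Matrix ι ι ℂ) (A : Matrix ι ι V) :
    pairing φ A = ∑ i, ∑ j, φ (A i j) i j := rfl

theorem pairing_single [DecidableEq ι] (φ : V →ₗ[ℂ] Matrix ι ι ℂ) (i j : ι) (v : V) :
    pairing φ (Matrix.single i j v) = φ v i j := by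
  rw [pairing_apply, Finset.sum_eq_single i, Finset.sum_eq_single j]
  · simp
  · intro b _ hb
    simp [Matrix.single_apply_of_col_ne _ _ hb.symm]
  · simp
  · intro b _ hb
    simp [Matrix.single_apply_of_row_ne hb.symm]
  · simp

/-- The linear map `V → M_ι` associated with a linear functional on `M_ι(V)`. -/
def ofFunctional [DecidableEq ι] (g : Matrix ι ι V →ₗ[ℂ] ℂ) : V →ₗ[ℂ] Matrix ι ι ℂ where
  toFun v := Matrix.of fun i j => g (Matrix.single i j v)
  map_add' v w := by
    ext i j
    simp [Matrix.single_add]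
  map_smul' r v := by
    ext i j
    simp [← Matrix.smul_single]

omit [Fintype ι] in
theorem ofFunctional_apply [DecidableEq ι] (g : Matrix ι ι V →ₗ[ℂ] ℂ) (v : V) (i j : ι) :
    ofFunctional g v i j = g (Matrix.single i j v) := rfl

theorem pairing_ofFunctional [DecidableEq ι] (g : Matrix ι ι V →ₗ[ℂ] ℂ) :
    pairing (ofFunctional g) = g := by
  ext A
  simp only [pairing_apply, ofFunctional_apply, ← map_sum]
  rw [← Matrix.matrix_eq_sum_single]

/-- A vector x in the amplified space is itself a κ × ι matrix, and compressing A by its adjoint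
brings the quadratic form back to M_ι(V). Positivity of one functional therefore controls
amplifications of every size. -/
theorem dotProduct_comp_map_mulVec (φ : V →ₗ[ℂ] Matrix ι ι ℂ) (A : Matrix κ κ V)
    (x : κ × ι → ℂ) :
    star x ⬝ᵥ (Matrix.comp κ κ ι ι ℂ (A.map φ) *ᵥ x) =
      pairing φ (matConj (Matrix.of fun i p => star (x (p, i))) A) := by
  simp only [pairing_apply, matConj_apply, map_sum, Matrix.sum_apply, map_smul, Matrix.smul_apply,
    dotProduct, Matrix.mulVec, Fintype.sum_prod_type, Matrix.comp_apply, Matrix.map_apply,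
    Matrix.of_apply, star_star, Finset.mul_sum, Pi.star_apply, smul_eq_mul]
  rw [Finset.sum_comm]
  refine Finset.sum_congr rfl fun i _ => ?_
  calc _ = ∑ p, ∑ j, ∑ q, star (x (p, i)) * (φ (A p q) i j * x (q, j)) :=
        Finset.sum_congr rfl fun p _ => Finset.sum_comm
    _ = ∑ j, ∑ p, ∑ q, star (x (p, i)) * (φ (A p q) i j * x (q, j)) := Finset.sum_comm
    _ = _ := by
      refine Finset.sum_congr rfl fun j _ => Finset.sum_congr rfl fun p _ =>
        Finset.sum_congr rfl fun q _ => ?_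
      ring

theorem pairing_nonneg_of_posSemidef {φ : V →ₗ[ℂ] Matrix ι ι ℂ} {A : Matrix ι ι V}
    (hA : (Matrix.comp ι ι ι ι ℂ (A.map φ)).PosSemidef) : 0 ≤ pairing φ A := by
  classical
  -- For the vector Σ e_i ⊗ e_i the compressing matrix is the identity.
  have h := hA.dotProduct_mulVec_nonneg (fun q : ι × ι => if q.2 = q.1 then 1 else 0)
  rw [dotProduct_comp_map_mulVec] at h
  have h1 : (Matrix.of fun i p => star (if i = p then (1 : ℂ) else 0)) = (1 : Matrix ι ι ℂ) := by
    ext i j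
    by_cases hij : i = j <;> simp [Matrix.one_apply, hij]
  rwa [h1, matConj_one] at h

theorem comp_map_conj {μ : Type*} [Fintype μ] [DecidableEq κ] {φ : V →ₗ[ℂ] Matrix ι ι ℂ}
    {φ' : V →ₗ[ℂ] Matrix μ μ ℂ} {γ : Matrix μ ι ℂ} (h : ∀ v, φ' v = γ * φ v * γᴴ)
    (A : Matrix κ κ V) :
    Matrix.comp κ κ μ μ ℂ (A.map φ') = ((1 : Matrix κ κ ℂ) ⊗ₖ γ) *
      Matrix.comp κ κ ι ι ℂ (A.map φ) * ((1 : Matrix κ κ ℂ) ⊗ₖ γ)ᴴ := by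
  ext ⟨p, i⟩ ⟨q, j⟩
  simp [h, Matrix.mul_apply, Fintype.sum_prod_type, Matrix.one_apply, Finset.sum_mul,
    apply_ite (starRingEnd ℂ)]

end Pairing

variable {V : Type*} [AddCommGroup V] [Module ℂ V] [StarAddMonoid V] [StarModule ℂ V]
  [OperatorSystem V] {ι κ : Type*} [Fintype ι] [Fintype κ]

theorem isArchimedeanCone_pos [DecidableEq ι] :
    IsArchimedeanCone {A : Matrix ι ι V | Pos A} (matUnit V ι) where
  star_eq h := Pos.isHermitian h
  zero_mem := pos_zero
  add_mem := Pos.add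
  smul_mem hr h := Pos.smul h hr
  unit_mem := pos_matUnit
  order_unit h := (exists_pos_add h).imp fun _ h => h.2
  eq_zero := Pos.eq_zero
  archimedean := pos_of_forall_add

/-- Positivity of the functional on `M_ι(V)` associated with `φ : V → M_ι`; this is complete
positivity of `φ`. -/
def PairingNonneg (φ : V →ₗ[ℂ] Matrix ι ι ℂ) : Prop :=
  ∀ A : Matrix ι ι V, Pos A → 0 ≤ pairing φ A

theorem PairingNonneg.map_star {φ : V →ₗ[ℂ] Matrix ι ι ℂ} (hφ : PairingNonneg φ) (v : V) :
    φ (star v) = (φ v)ᴴ := by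
  classical
  ext i j
  have h := isArchimedeanCone_pos.map_star_of_nonneg (g := pairing φ) hφ (Matrix.single j i v)
  rw [Matrix.star_eq_conjTranspose, Matrix.conjTranspose_single, pairing_single,
    pairing_single] at h
  exact h

theorem PairingNonneg.posSemidef_comp {φ : V →ₗ[ℂ] Matrix ι ι ℂ} (hφ : PairingNonneg φ)
    {A : Matrix κ κ V} (hA : Pos A) : (Matrix.comp κ κ ι ι ℂ (A.map φ)).PosSemidef := by
  refine Matrix.PosSemidef.of_dotProduct_mulVec_nonneg ?_ fun x => ?_
  · ext ⟨p, i⟩ ⟨q, j⟩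
    have h1 := congrFun (congrFun hA.isHermitian p) q
    rw [Matrix.conjTranspose_apply] at h1
    simp only [Matrix.conjTranspose_apply, Matrix.comp_apply, Matrix.map_apply]
    rw [← h1, hφ.map_star, Matrix.conjTranspose_apply]
  · rw [dotProduct_comp_map_mulVec]
    exact hφ _ (hA.matConj _)

theorem isCompletelyPositive_iff_pairingNonneg {n : ℕ}
    {φ : V →ₗ[ℂ] Matrix (Fin n) (Fin n) ℂ} :
    IsCompletelyPositive (cone (V := V)) (cone (V := Matrix (Fin n) (Fin n) ℂ)) φ ↔
      PairingNonneg φ :=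
  ⟨fun h A hA => pairing_nonneg_of_posSemidef (h n A (pos_iff_mem.1 hA)),
    fun h _ _ hA => h.posSemidef_comp (pos_iff_mem.2 hA)⟩

/-- Every completely positive map into a matrix algebra is a compression of a unital one. -/
theorem PairingNonneg.exists_isUCP [DecidableEq ι] {φ : V →ₗ[ℂ] Matrix ι ι ℂ}
    (hφ : PairingNonneg φ) :
    ∃ (m : ℕ) (φ' : V →ₗ[ℂ] Matrix (Fin m) (Fin m) ℂ) (β : Matrix ι (Fin m) ℂ),
      IsUCP φ' ∧ ∀ v, φ v = β * φ' v * βᴴ := by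
  have hpsd : ∀ v : V, Pos (Matrix.of fun _ _ => v : Matrix Unit Unit V) → (φ v).PosSemidef := fun v hv =>
    (hφ.posSemidef_comp hv).submatrix fun i => ((), i)
  have hunit : Pos (Matrix.of fun _ _ => unit : Matrix Unit Unit V) := by
    have h := pos_matUnit (V := V) (ι := Unit)
    have h1 : matUnit V Unit = Matrix.of fun _ _ => unit := by
      ext i j; simp [matUnit, Subsingleton.elim i j]
    rwa [h1] at h
  obtain ⟨m, β, γ, h1, h2⟩ := (hpsd _ hunit).exists_support
  -- If φ(1)x = 0, then φ(v)x = φ(r1 + v)x with r1 + v positive, so ⟨φ(v)x, x⟩ ≥ 0. The same for −v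
  -- makes this form vanish, and a positive semidefinite matrix kills a vector on which its form
  -- vanishes. So φ lives on the support of φ(1), where φ(1) can be normalised to 1.
  have hker : ∀ v : V, star v = v → ∀ x, φ unit *ᵥ x = 0 → φ v *ᵥ x = 0 := fun v hv x hx => by
    have key : ∀ w : V, star w = w → 0 ≤ star x ⬝ᵥ (φ w *ᵥ x) ∧
        (star x ⬝ᵥ (φ w *ᵥ x) = 0 → φ w *ᵥ x = 0) := fun w hw => by
      obtain ⟨r, -, hr⟩ := exists_pos_add (ι := Unit) (A := (Matrix.of fun _ _ => w : Matrix Unit Unit V))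
        (by ext i j; exact hw)
      have h3 : (r : ℂ) • matUnit V Unit + (Matrix.of fun _ _ => w : Matrix Unit Unit V) =
          Matrix.of fun _ _ => (r : ℂ) • unit + w := by
        ext i j; simp [matUnit, Subsingleton.elim i j]
      rw [h3] at hr
      have h4 := hpsd _ hr
      have h5 : φ ((r : ℂ) • unit + w) *ᵥ x = φ w *ᵥ x := by
        rw [map_add, map_smul, Matrix.add_mulVec, Matrix.smul_mulVec, hx, smul_zero, zero_add]
      rw [← h5]
      exact ⟨h4.dotProduct_mulVec_nonneg x, (h4.dotProduct_mulVec_zero_iff x).1⟩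
    refine (key v hv).2 (le_antisymm ?_ (key v hv).1)
    have := (key (-v) (by rw [star_neg, hv])).1
    rwa [map_neg, Matrix.neg_mulVec, dotProduct_neg, Left.nonneg_neg_iff] at this
  have hker' : ∀ v : V, ∀ x, φ unit *ᵥ x = 0 → φ v *ᵥ x = 0 := fun v x hx => by
    have hv : v = (1 / 2 : ℂ) • (v + star v) - (Complex.I / 2) • (Complex.I • (v - star v)) := by
      rw [smul_smul, show Complex.I / 2 * Complex.I = -(1 / 2 : ℂ) by
        rw [div_mul_eq_mul_div, Complex.I_mul_I, neg_div]]
      module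
    rw [hv, map_sub, map_smul, map_smul, Matrix.sub_mulVec, Matrix.smul_mulVec,
      Matrix.smul_mulVec, hker _ (by simp [add_comm]) x hx, hker _ (by
        rw [star_smul, star_sub, star_star, Complex.star_def, Complex.conj_I, neg_smul, ← smul_neg,
          neg_sub]) x hx]
    simp
  have hP : ∀ v, φ v * (γᴴ * βᴴ) = φ v := fun v => h2 _ (hker' v)
  have hP' : ∀ v, (β * γ) * φ v = φ v := fun v => by
    have := congrArg Matrix.conjTranspose (hP (star v))
    rwa [Matrix.conjTranspose_mul, hφ.map_star, Matrix.conjTranspose_conjTranspose,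
      Matrix.conjTranspose_mul, Matrix.conjTranspose_conjTranspose,
      Matrix.conjTranspose_conjTranspose] at this
  let φ' : V →ₗ[ℂ] Matrix (Fin m) (Fin m) ℂ :=
    { toFun := fun v => γ * φ v * γᴴ
      map_add' := fun v w => by rw [map_add, Matrix.mul_add, Matrix.add_mul]
      map_smul' := fun r v => by
        rw [map_smul, Matrix.mul_smul, Matrix.smul_mul, RingHom.id_apply] }
  have hφ' : ∀ v, φ' v = γ * φ v * γᴴ := fun v => rfl
  refine ⟨m, φ', β, ⟨h1, fun n A hA => ?_⟩, fun v => ?_⟩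
  · change Matrix.PosSemidef _
    rw [comp_map_conj hφ']
    exact (hφ.posSemidef_comp (pos_iff_mem.2 hA)).mul_mul_conjTranspose_same _
  · rw [hφ', show β * (γ * φ v * γᴴ) * βᴴ = (β * γ) * (φ v * (γᴴ * βᴴ)) by
      simp only [Matrix.mul_assoc], hP, hP']

/-- The cones of an operator system are determined by its unital completely positive maps into
matrix algebras. -/
theorem pos_of_forall_isUCP {A : Matrix ι ι V}
    (h : ∀ (k : ℕ) (ρ : V →ₗ[ℂ] Matrix (Fin k) (Fin k) ℂ), IsUCP ρ →
      (Matrix.comp ι ι (Fin k) (Fin k) ℂ (A.map ρ)).PosSemidef) : Pos A := by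
  classical
  -- Each testing functional g is the pairing with a cp map into M_ι, and that map is a compression
  -- of a ucp map covered by the hypothesis.
  refine isArchimedeanCone_pos.mem_of_forall_state fun g hg _ => ?_
  rw [← pairing_ofFunctional g] at hg ⊢
  obtain ⟨m, ρ, β, hρ, hβ⟩ := PairingNonneg.exists_isUCP hg
  refine pairing_nonneg_of_posSemidef ?_
  rw [comp_map_conj hβ]
  exact (h m ρ hρ).mul_mul_conjTranspose_same _

/-- Completely positive maps into matrix algebras extend along complete order embeddings. -/
theorem PairingNonneg.exists_extension {E : Type*} [AddCommGroup E] [Module ℂ E]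
    [StarAddMonoid E] [StarModule ℂ E] [OperatorSystem E] (j : E →ₗ[ℂ] V)
    (hinj : Function.Injective j) (hunit : j unit = unit) (hstar : ∀ x, j (star x) = star (j x))
    (hpos : ∀ A : Matrix ι ι E, Pos (A.map j) → Pos A) {φ : E →ₗ[ℂ] Matrix ι ι ℂ}
    (hφ : PairingNonneg φ) :
    ∃ φ' : V →ₗ[ℂ] Matrix ι ι ℂ, PairingNonneg φ' ∧ ∀ x, φ' (j x) = φ x := by
  classical
  let J : Matrix ι ι E →ₗ[ℂ] Matrix ι ι V := j.mapMatrix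
  have hJ : Function.Injective J := fun A B h => by
    ext i k
    exact hinj (congrFun (congrFun h i) k)
  have hJA : ∀ A, J A = A.map j := fun A => rfl
  let F := LinearEquiv.ofInjective J hJ
  -- The associated functional is extended from the copy of M_ι(E) inside M_ι(V), then read back as
  -- a map into M_ι.
  obtain ⟨g, hg, hgpos⟩ := isArchimedeanCone_pos.exists_extension
    (LinearMap.range J) ⟨matUnit E ι, by
      rw [hJA, matUnit, Matrix.diagonal_map (map_zero j), matUnit]
      simp [hunit]⟩ (by
      rintro _ ⟨A, rfl⟩
      refine ⟨star A, ?_⟩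
      ext i k
      exact hstar _)
    (pairing φ ∘ₗ F.symm.toLinearMap) (by
      intro x hx
      obtain ⟨A, rfl⟩ := F.surjective x
      rw [LinearMap.comp_apply, LinearEquiv.coe_coe, LinearEquiv.symm_apply_apply]
      exact hφ A (hpos A hx))
  refine ⟨ofFunctional g, fun A hA => ?_, fun x => ?_⟩
  · rw [pairing_ofFunctional]
    exact hgpos A hA
  · ext i k
    have h1 := hg (F (Matrix.single i k x))
    rw [LinearMap.comp_apply, LinearEquiv.coe_coe, LinearEquiv.symm_apply_apply,
      pairing_single] at h1
    rw [ofFunctional_apply, ← h1]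
    congr 1
    ext a b
    simp [F, hJA, Matrix.single_apply, apply_ite j]

end OperatorSystem

theorem matConj_submatrix_equiv {V : Type*} [AddCommGroup V] [Module ℂ V] {ι κ μ : Type*}
    [Fintype κ] [Fintype μ] (e : μ ≃ κ) (α : Matrix ι κ ℂ) (A : Matrix κ κ V) :
    matConj (α.submatrix id e) (A.submatrix e e) = matConj α A := by
  ext i j
  simp only [matConj_apply, Matrix.submatrix_apply, id]
  rw [e.sum_comp fun k => ∑ l, (α i k * star (α j (e l))) • A k (e l)]
  exact Finset.sum_congr rfl fun k _ => e.sum_comp fun l => (α i k * star (α j l)) • A k l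

namespace OperatorSystem

/-! ### States of an operator system. -/

section States

variable {V : Type*} [AddCommGroup V] [Module ℂ V] [StarAddMonoid V] [StarModule ℂ V]
  [OperatorSystem V]

/-- Positivity of an element of an operator system. -/
def Nonneg (v : V) : Prop := Pos (Matrix.of fun _ _ => v : Matrix Unit Unit V)

theorem Pos.nonneg_apply {ι : Type*} [Fintype ι] {A : Matrix ι ι V} (hA : Pos A) (i : ι) :
    Nonneg (A i i) :=
  hA.submatrix fun _ : Unit => i

theorem smul_matUnit_unit (r : ℂ) :
    r • matUnit V Unit = (Matrix.of fun _ _ => r • unit : Matrix Unit Unit V) := by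
  ext i j
  simp [matUnit, Subsingleton.elim i j]

theorem isArchimedeanCone_nonneg : IsArchimedeanCone {v : V | Nonneg v} unit where
  star_eq h := congrFun (congrFun (Pos.isHermitian h) ()) ()
  zero_mem := pos_zero
  add_mem := Pos.add
  smul_mem hr h := Pos.smul h hr
  unit_mem := by
    have := pos_matUnit (V := V) (ι := Unit)
    rwa [← one_smul ℂ (matUnit V Unit), smul_matUnit_unit, one_smul] at this
  order_unit {x} h := by
    obtain ⟨r, -, hr⟩ := exists_pos_add (ι := Unit)
      (A := (Matrix.of fun _ _ => x : Matrix Unit Unit V)) (by ext; exact h)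
    rw [smul_matUnit_unit] at hr
    exact ⟨r, hr⟩
  eq_zero h h' := congrFun (congrFun (Pos.eq_zero h h') ()) ()
  archimedean {x} h h' := pos_of_forall_add (ι := Unit)
    (A := (Matrix.of fun _ _ => x : Matrix Unit Unit V)) (by ext; exact h) fun r hr => by
      rw [smul_matUnit_unit]
      exact h' r hr

/-- The states of an operator system. -/
def IsState (p : V →ₗ[ℂ] ℂ) : Prop := (∀ v, Nonneg v → 0 ≤ p v) ∧ p unit = 1

theorem IsState.map_star {p : V →ₗ[ℂ] ℂ} (hp : IsState p) (v : V) : p (star v) = star (p v) :=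
  isArchimedeanCone_nonneg.map_star_of_nonneg hp.1 v

theorem eq_zero_of_forall_isState {v : V} (h : ∀ p : V →ₗ[ℂ] ℂ, IsState p → p v = 0) : v = 0 :=
  isArchimedeanCone_nonneg.eq_zero_of_forall_state fun p hp hp' => h p ⟨hp, hp'⟩

/-- A linear functional, viewed as a map into the `1 × 1` matrices. -/
def toMatrixOne (p : V →ₗ[ℂ] ℂ) : V →ₗ[ℂ] Matrix (Fin 1) (Fin 1) ℂ where
  toFun v := Matrix.of fun _ _ => p v
  map_add' v w := by ext; simp
  map_smul' r v := by ext; simp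

theorem IsState.isUCP {p : V →ₗ[ℂ] ℂ} (hp : IsState p) : IsUCP (toMatrixOne p) := by
  refine ⟨?_, isCompletelyPositive_iff_pairingNonneg.2 fun A hA => ?_⟩
  · change _ = (1 : Matrix (Fin 1) (Fin 1) ℂ)
    ext i j
    simp [toMatrixOne, hp.2, Matrix.one_apply, Subsingleton.elim i j]
  · simpa [pairing_apply, toMatrixOne] using hp.1 _ (hA.nonneg_apply 0)

end States

/-! ### Slice maps and hermitian decompositions in the tensor product. -/

section Tensor

variable {V W : Type*} [AddCommGroup V] [Module ℂ V] [AddCommGroup W] [Module ℂ W]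

/-- The slice map `id ⊗ q : V ⊗ W → V` of a functional `q` on `W`. -/
noncomputable def sliceRight (V : Type*) [AddCommGroup V] [Module ℂ V] (q : W →ₗ[ℂ] ℂ) :
    V ⊗[ℂ] W →ₗ[ℂ] V :=
  (TensorProduct.rid ℂ V).toLinearMap ∘ₗ q.lTensor V

@[simp]
theorem sliceRight_tmul (q : W →ₗ[ℂ] ℂ) (v : V) (w : W) :
    sliceRight V q (v ⊗ₜ w) = q w • v := by
  simp [sliceRight]

/-- The slice map `p ⊗ id : V ⊗ W → W` of a functional `p` on `V`. -/
noncomputable def sliceLeft (W : Type*) [AddCommGroup W] [Module ℂ W] (p : V →ₗ[ℂ] ℂ) :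
    V ⊗[ℂ] W →ₗ[ℂ] W :=
  (TensorProduct.lid ℂ W).toLinearMap ∘ₗ p.rTensor W

@[simp]
theorem sliceLeft_tmul (p : V →ₗ[ℂ] ℂ) (v : V) (w : W) :
    sliceLeft W p (v ⊗ₜ w) = p v • w := by
  simp [sliceLeft]

theorem apply_sliceLeft (p : V →ₗ[ℂ] ℂ) (q : W →ₗ[ℂ] ℂ) (z : V ⊗[ℂ] W) :
    q (sliceLeft W p z) = p (sliceRight V q z) := by
  induction z with
  | zero => simp
  | tmul v w => simp [mul_comm]
  | add x y hx hy => simp [hx, hy]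

theorem tensor_eq_zero_of_sliceRight {z : V ⊗[ℂ] W} (h : ∀ q : W →ₗ[ℂ] ℂ, sliceRight V q z = 0) :
    z = 0 := by
  classical
  let b := Module.Basis.ofVectorSpace ℂ W
  apply (TensorProduct.equivFinsuppOfBasisRight (M := V) b).injective
  rw [map_zero]
  ext i
  have key : ∀ y : V ⊗[ℂ] W,
      TensorProduct.equivFinsuppOfBasisRight (M := V) b y i = sliceRight V (b.coord i) y := by
    intro y
    induction y with
    | zero => simp
    | tmul v w => simp
    | add x y hx hy => simp [hx, hy]
  rw [key, h]
  rfl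

theorem tensorToMatrix_tmul {k m : ℕ} (φ : V →ₗ[ℂ] Matrix (Fin k) (Fin k) ℂ)
    (ψ : W →ₗ[ℂ] Matrix (Fin m) (Fin m) ℂ) (v : V) (w : W) :
    tensorToMatrix φ ψ (v ⊗ₜ w) = φ v ⊗ₖ ψ w := by
  simp [tensorToMatrix]

theorem apply_sliceRight {k m : ℕ} (φ : V →ₗ[ℂ] Matrix (Fin k) (Fin k) ℂ)
    (ψ : W →ₗ[ℂ] Matrix (Fin m) (Fin m) ℂ) (a b : Fin m) (c d : Fin k) (z : V ⊗[ℂ] W) :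
    φ (sliceRight V (Matrix.entryLinearMap ℂ ℂ a b ∘ₗ ψ) z) c d =
      tensorToMatrix φ ψ z (c, a) (d, b) := by
  induction z with
  | zero => simp
  | tmul v w => simp [tensorToMatrix_tmul, mul_comm]
  | add x y hx hy => simp [hx, hy]

/-- The matrix `[v ⊗ A_{ij}]`. -/
def tmulMatrix {ι : Type*} (v : V) (A : Matrix ι ι W) : Matrix ι ι (V ⊗[ℂ] W) :=
  Matrix.of fun i j => v ⊗ₜ A i j

theorem exists_eq_sum_tmulMatrix [StarAddMonoid V] [StarModule ℂ V] {ι : Type*} [Fintype ι]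
    (X : Matrix ι ι (V ⊗[ℂ] W)) :
    ∃ (σ : Type) (_ : Fintype σ) (a : σ → V) (B : σ → Matrix ι ι W),
      (∀ s, star (a s) = a s) ∧ X = ∑ s, tmulMatrix (a s) (B s) := by
  classical
  let P : Matrix ι ι (V ⊗[ℂ] W) → Prop := fun X =>
    ∃ (σ : Type) (_ : Fintype σ) (a : σ → V) (B : σ → Matrix ι ι W),
      (∀ s, star (a s) = a s) ∧ X = ∑ s, tmulMatrix (a s) (B s)
  have hadd : ∀ X Y, P X → P Y → P (X + Y) := by
    rintro _ _ ⟨σ, _, a, B, ha, rfl⟩ ⟨τ, _, a', B', ha', rfl⟩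
    refine ⟨σ ⊕ τ, inferInstance, Sum.elim a a', Sum.elim B B', ?_, ?_⟩
    · rintro (s | s)
      exacts [ha s, ha' s]
    · simp
  have hzero : P 0 := ⟨Empty, inferInstance, Empty.elim, Empty.elim, fun s => s.elim, by simp⟩
  have hone : ∀ (v : V) (B : Matrix ι ι W), star v = v → P (tmulMatrix v B) := fun v B hv =>
    ⟨Unit, inferInstance, fun _ => v, fun _ => B, fun _ => hv, by simp⟩
  have hsingle : ∀ i j (z : V ⊗[ℂ] W), P (Matrix.single i j z) := by
    intro i j z
    induction z with
    | zero => simpa using hzero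
    | tmul v w =>
      -- Splits v into real and imaginary parts, moving the scalars to w so that the first legs are
      -- hermitian.
      have h : Matrix.single i j (v ⊗ₜ[ℂ] w) =
          tmulMatrix (v + star v) (Matrix.single i j ((1 / 2 : ℂ) • w)) +
          tmulMatrix (Complex.I • (v - star v)) (Matrix.single i j ((-Complex.I / 2) • w)) := by
        ext a b
        by_cases hab : i = a ∧ j = b
        · obtain ⟨rfl, rfl⟩ := hab
          simp only [tmulMatrix, Matrix.add_apply, Matrix.of_apply, Matrix.single_apply_same,
            TensorProduct.tmul_smul, TensorProduct.smul_tmul', smul_smul]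
          rw [show -Complex.I / 2 * Complex.I = (1 / 2 : ℂ) by
            rw [div_mul_eq_mul_div, neg_mul, Complex.I_mul_I, neg_neg]]
          rw [← TensorProduct.add_tmul, ← smul_add]
          congr 1
          module
        · simp [tmulMatrix, Matrix.single_apply_of_ne (h := hab)]
      rw [h]
      refine hadd _ _ (hone _ _ (by simp [add_comm])) (hone _ _ ?_)
      rw [star_smul, star_sub, star_star, Complex.star_def, Complex.conj_I, neg_smul, ← smul_neg,
        neg_sub]
    | add x y hx hy =>
      rw [Matrix.single_add]
      exact hadd _ _ hx hy
  change P X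
  rw [Matrix.matrix_eq_sum_single X]
  exact Finset.sum_induction _ P hadd hzero fun i _ =>
    Finset.sum_induction _ P hadd hzero fun j _ => hsingle i j _

variable [StarAddMonoid V] [StarModule ℂ V] [OperatorSystem V] [StarAddMonoid W] [StarModule ℂ W]
  [OperatorSystem W]

theorem tensor_eq_zero_of_forall_isState {z : V ⊗[ℂ] W}
    (h : ∀ (p : V →ₗ[ℂ] ℂ) (q : W →ₗ[ℂ] ℂ), IsState p → IsState q → p (sliceRight V q z) = 0) :
    z = 0 := by
  refine tensor_eq_zero_of_sliceRight fun q => eq_zero_of_forall_isState fun p hp => ?_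
  rw [← apply_sliceLeft, eq_zero_of_forall_isState (v := sliceLeft W p z) fun q hq => ?_, map_zero]
  rw [apply_sliceLeft]
  exact h p q hp hq

/-- Product states are ucp maps into 1 × 1 matrices. Testing with them expresses that X is hermitian
without an involution on V ⊗ W. -/
theorem minCone_apply_sliceRight {n : ℕ} {X : Matrix (Fin n) (Fin n) (V ⊗[ℂ] W)}
    (hX : X ∈ minCone V W n) {p : V →ₗ[ℂ] ℂ} {q : W →ₗ[ℂ] ℂ} (hp : IsState p) (hq : IsState q)
    (i j : Fin n) : star (p (sliceRight V q (X j i))) = p (sliceRight V q (X i j)) := by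
  have h := congrFun (congrFun (hX 1 1 _ _ hp.isUCP hq.isUCP).1 (i, (0, 0))) (j, (0, 0))
  have key : ∀ z : V ⊗[ℂ] W, tensorToMatrix (toMatrixOne p) (toMatrixOne q) z (0, 0) (0, 0) =
      p (sliceRight V q z) := fun z => by
    rw [← apply_sliceRight]
    rfl
  simpa only [Matrix.conjTranspose_apply, Matrix.comp_apply, Matrix.map_apply, key] using h

/-- Matrices in the minimal cone are finite sums of hermitian elementary tensors. -/
theorem exists_isHermitian_of_mem_minCone {n : ℕ} {X : Matrix (Fin n) (Fin n) (V ⊗[ℂ] W)}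
    (hX : X ∈ minCone V W n) :
    ∃ (σ : Type) (_ : Fintype σ) (a : σ → V) (B : σ → Matrix (Fin n) (Fin n) W),
      (∀ s, star (a s) = a s) ∧ (∀ s, (B s).IsHermitian) ∧ X = ∑ s, tmulMatrix (a s) (B s) := by
  obtain ⟨σ, _, a, B, ha, h⟩ := exists_eq_sum_tmulMatrix X
  refine ⟨σ, inferInstance, a, fun s => (1 / 2 : ℂ) • (B s + (B s)ᴴ), ha, fun s => ?_, ?_⟩
  · rw [Matrix.IsHermitian, Matrix.conjTranspose_smul, Matrix.conjTranspose_add,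
      Matrix.conjTranspose_conjTranspose, add_comm]
    congr 1
    simp
  · have h' : X = ∑ s, tmulMatrix (a s) (B s)ᴴ := by
      ext i j
      rw [← sub_eq_zero]
      refine tensor_eq_zero_of_forall_isState fun p q hp hq => ?_
      rw [map_sub, map_sub, ← minCone_apply_sliceRight hX hp hq, h]
      simp only [Matrix.sum_apply, map_sum, tmulMatrix, Matrix.of_apply, sliceRight_tmul, map_smul,
        smul_eq_mul, star_sum, star_mul', ← hp.map_star, ← hq.map_star, ha,
        Matrix.conjTranspose_apply, sub_self]
    have h2 : X = (1 / 2 : ℂ) • (X + X) := by module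
    rw [h2]
    nth_rw 1 [h]
    rw [h', ← Finset.sum_add_distrib, Finset.smul_sum]
    refine Finset.sum_congr rfl fun s _ => ?_
    ext i j
    simp [tmulMatrix, TensorProduct.tmul_add]

end Tensor

theorem Pos.fromBlocks {V : Type*} [AddCommGroup V] [Module ℂ V] [StarAddMonoid V]
    [StarModule ℂ V] [OperatorSystem V] {ι κ : Type*} [Fintype ι] [Fintype κ] {A : Matrix ι ι V}
    {B : Matrix κ κ V} (hA : Pos A) (hB : Pos B) : Pos (Matrix.fromBlocks A 0 0 B) := by
  classical
  have h := (hA.matConj (Matrix.of fun (i : ι ⊕ κ) j => if i = Sum.inl j then 1 else 0)).add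
    (hB.matConj (Matrix.of fun (i : ι ⊕ κ) j => if i = Sum.inr j then 1 else 0))
  convert h using 1
  ext (i | i) (j | j) <;> simp [matConj_apply, apply_ite (starRingEnd ℂ), ite_smul]

/-! ### The maximal pre-cone. -/

section MaxCone

variable {V W : Type*} [AddCommGroup V] [Module ℂ V] [StarAddMonoid V] [StarModule ℂ V]
  [OperatorSystem V] [AddCommGroup W] [Module ℂ W] [StarAddMonoid W] [StarModule ℂ W]
  [OperatorSystem W] {n : ℕ}

theorem matConj_kroneckerTMul_mem_maxPreCone {κ μ : Type*} [Fintype κ] [Fintype μ]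
    {P : Matrix κ κ V} {Q : Matrix μ μ W} (hP : Pos P) (hQ : Pos Q)
    (α : Matrix (Fin n) (κ × μ) ℂ) : matConj α (P ⊗ₖₜ[ℂ] Q) ∈ maxPreCone V W n := by
  let e := ((Fintype.equivFin κ).symm.prodCongr (Fintype.equivFin μ).symm)
  refine ⟨_, _, _, _, α.submatrix id e, pos_iff_mem_card.1 hP, pos_iff_mem_card.1 hQ, ?_⟩
  rw [← matConj_submatrix_equiv e]
  rfl

theorem zero_mem_maxPreCone : 0 ∈ maxPreCone V W n := by
  have h := matConj_kroneckerTMul_mem_maxPreCone (n := n) (pos_zero (V := V) (ι := Unit))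
    (pos_zero (V := W) (ι := Unit)) 0
  rwa [Matrix.zero_kroneckerTMul, matConj_zero] at h

theorem add_mem_maxPreCone {X Y : Matrix (Fin n) (Fin n) (V ⊗[ℂ] W)}
    (hX : X ∈ maxPreCone V W n) (hY : Y ∈ maxPreCone V W n) : X + Y ∈ maxPreCone V W n := by
  obtain ⟨k, l, P, Q, α, hP, hQ, rfl⟩ := hX
  obtain ⟨k', l', P', Q', α', hP', hQ', rfl⟩ := hY
  rw [← pos_iff_mem] at hP hQ hP' hQ'
  -- Compressing (P ⊕ P') ⊗ (Q ⊕ Q') by a matrix that vanishes on the mixed blocks leaves only P ⊗ Q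
  -- and P' ⊗ Q'.
  let β : Matrix (Fin n) ((Fin k ⊕ Fin k') × (Fin l ⊕ Fin l')) ℂ := Matrix.of fun i p =>
    match p with
    | (Sum.inl a, Sum.inl b) => α i (a, b)
    | (Sum.inr a, Sum.inr b) => α' i (a, b)
    | _ => 0
  have h := matConj_kroneckerTMul_mem_maxPreCone (hP.fromBlocks hP') (hQ.fromBlocks hQ') β
  convert h using 1
  ext i j
  simp [matConj_apply, Fintype.sum_prod_type, β]

theorem sum_mem_maxPreCone {σ : Type*} (s : Finset σ) {X : σ → Matrix (Fin n) (Fin n) (V ⊗[ℂ] W)}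
    (h : ∀ x ∈ s, X x ∈ maxPreCone V W n) : ∑ x ∈ s, X x ∈ maxPreCone V W n :=
  Finset.sum_induction X (· ∈ maxPreCone V W n) (fun _ _ => add_mem_maxPreCone)
    zero_mem_maxPreCone h

theorem smul_mem_maxPreCone {X : Matrix (Fin n) (Fin n) (V ⊗[ℂ] W)} (hX : X ∈ maxPreCone V W n)
    {r : ℝ} (hr : 0 ≤ r) : (r : ℂ) • X ∈ maxPreCone V W n := by
  obtain ⟨k, l, P, Q, α, hP, hQ, rfl⟩ := hX
  refine ⟨k, l, (r : ℂ) • P, Q, α, pos_iff_mem.1 ((pos_iff_mem.2 hP).smul hr), hQ, ?_⟩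
  rw [Matrix.smul_kroneckerTMul, matConj_smul]

theorem tmulMatrix_mem_maxPreCone {v : V} (hv : Nonneg v) {A : Matrix (Fin n) (Fin n) W}
    (hA : Pos A) : tmulMatrix v A ∈ maxPreCone V W n := by
  have h := matConj_kroneckerTMul_mem_maxPreCone hv hA
    ((1 : Matrix (Fin n) (Fin n) ℂ).submatrix id Prod.snd)
  convert h using 1
  ext i j
  simp [matConj_apply, Fintype.sum_prod_type, tmulMatrix, Matrix.one_apply,
    apply_ite (starRingEnd ℂ), ite_smul]

variable (V W n) in
/-- The unit of `M_n(V ⊗ W)`. -/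
def tensorUnit : Matrix (Fin n) (Fin n) (V ⊗[ℂ] W) := tmulMatrix (unit : V) (matUnit W (Fin n))

theorem smul_tensorUnit (r : ℂ) : r • tensorUnit V W n =
    Matrix.diagonal fun _ => r • ((unit : V) ⊗ₜ[ℂ] (unit : W)) := by
  ext i j
  by_cases h : i = j
  · subst h
    simp [tensorUnit, tmulMatrix, matUnit]
  · simp [tensorUnit, tmulMatrix, matUnit, h]

theorem tensorUnit_mem_maxPreCone : tensorUnit V W n ∈ maxPreCone V W n :=
  tmulMatrix_mem_maxPreCone isArchimedeanCone_nonneg.unit_mem pos_matUnit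

/-- Half the sum of (r1 + v) ⊗ (δ1 + A) and (r1 − v) ⊗ (δ1 − A) is rδ(1 ⊗ 1) + v ⊗ A. This bounds
the error of an approximate factorization. -/
theorem smul_tensorUnit_add_tmulMatrix_mem {v : V} {A : Matrix (Fin n) (Fin n) W} {r δ : ℝ}
    (hv : Nonneg ((r : ℂ) • unit + v)) (hv' : Nonneg ((r : ℂ) • unit - v))
    (hA : Pos ((δ : ℂ) • matUnit W (Fin n) + A)) (hA' : Pos ((δ : ℂ) • matUnit W (Fin n) - A)) :
    ((r * δ : ℝ) : ℂ) • tensorUnit V W n + tmulMatrix v A ∈ maxPreCone V W n := by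
  have h := smul_mem_maxPreCone (add_mem_maxPreCone (tmulMatrix_mem_maxPreCone hv hA)
    (tmulMatrix_mem_maxPreCone hv' hA')) (r := 1 / 2) (by norm_num)
  convert h using 1
  ext i j
  simp only [tensorUnit, tmulMatrix, Matrix.add_apply, Matrix.sub_apply, Matrix.smul_apply,
    Matrix.of_apply, TensorProduct.tmul_add, TensorProduct.add_tmul, TensorProduct.sub_tmul,
    TensorProduct.tmul_sub, TensorProduct.tmul_smul, ← TensorProduct.smul_tmul']
  push_cast
  module

theorem pos_matrix_single (N : ℕ) : Pos (Matrix.of fun a b =>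
    (Matrix.single a b 1 : Matrix (Fin N) (Fin N) ℂ)) := by
  rw [pos_iff_mem]
  change Matrix.PosSemidef _
  convert Matrix.posSemidef_vecMulVec_self_star
    (fun p : Fin N × Fin N => if p.1 = p.2 then (1 : ℂ) else 0) using 1
  ext ⟨p, i⟩ ⟨q, j⟩
  by_cases hp : p = i <;> by_cases hq : q = j <;>
    simp [Matrix.vecMulVec_apply, hp, hq]

/-- Tensoring a map that factors through a matrix algebra with the identity takes the minimal
cones into the maximal ones. -/
theorem map_mem_maxPreCone {T : Type*} [AddCommGroup T] [Module ℂ T] [StarAddMonoid T]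
    [StarModule ℂ T] [OperatorSystem T] {N : ℕ} {φ : W →ₗ[ℂ] Matrix (Fin N) (Fin N) ℂ}
    {ψ : Matrix (Fin N) (Fin N) ℂ →ₗ[ℂ] T} (hφ : IsUCP φ) (hψ : IsUCP ψ)
    {X : Matrix (Fin n) (Fin n) (V ⊗[ℂ] W)} (hX : X ∈ minCone V W n) :
    X.map (TensorProduct.map LinearMap.id (ψ ∘ₗ φ)) ∈ maxPreCone V T n := by
  -- Y is (id ⊗ φ)(X) with the M_N entries spread out as indices; for ucp ρ, applying ρ to Y gives
  -- (ρ ⊗ φ)(X) up to reindexing.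
  let Y : Matrix (Fin n × Fin N) (Fin n × Fin N) V := Matrix.of fun p q =>
    sliceRight V (Matrix.entryLinearMap ℂ ℂ p.2 q.2 ∘ₗ φ) (X p.1 q.1)
  have hY : Pos Y := by
    refine pos_of_forall_isUCP fun k ρ hρ => ?_
    convert (hX k N ρ φ hρ hφ).submatrix
      (fun p : (Fin n × Fin N) × Fin k => (p.1.1, (p.2, p.1.2))) using 1
    ext ⟨⟨i, a⟩, c⟩ ⟨⟨j, b⟩, d⟩
    exact apply_sliceRight ρ φ a b c d (X i j)
  have hQ := pos_iff_mem.2 (hψ.2 N _ (pos_iff_mem.1 (pos_matrix_single N)))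
  -- This matrix identifies the M_N index of Y with that of [ψ(e_ab)] and sums over it.
  have h := matConj_kroneckerTMul_mem_maxPreCone hY hQ (n := n) (Matrix.of fun i p =>
    (if i = p.1.1 then 1 else 0) * (if p.1.2 = p.2 then 1 else 0))
  convert h using 1
  have key : ∀ z : V ⊗[ℂ] W, TensorProduct.map LinearMap.id (ψ ∘ₗ φ) z = ∑ a, ∑ b,
      sliceRight V (Matrix.entryLinearMap ℂ ℂ a b ∘ₗ φ) z ⊗ₜ[ℂ] ψ (Matrix.single a b 1) := by
    intro z
    induction z with
    | zero => simp
    | tmul v w =>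
      simp only [TensorProduct.map_tmul, LinearMap.id_apply, LinearMap.comp_apply, sliceRight_tmul,
        TensorProduct.smul_tmul, ← TensorProduct.tmul_sum, ← map_smul, ← map_sum,
        Matrix.entryLinearMap_apply, Matrix.smul_single, smul_eq_mul, mul_one]
      rw [← Matrix.matrix_eq_sum_single]
    | add x y hx hy => simp [hx, hy, TensorProduct.add_tmul, Finset.sum_add_distrib]
  ext i j
  rw [Matrix.map_apply, key]
  simp [matConj_apply, Fintype.sum_prod_type, apply_ite (starRingEnd ℂ), ite_smul, Y]

end MaxCone

end OperatorSystem

namespace OperatorSystem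

/-! ### The order norm. -/

section Norm

variable {V : Type*} [AddCommGroup V] [Module ℂ V] [StarAddMonoid V] [StarModule ℂ V]
  [OperatorSystem V]

theorem smul_matUnit_two (r : ℂ) :
    r • matUnit V (Fin 2) = !![r • unit, 0; 0, r • unit] := by
  ext i j
  fin_cases i <;> fin_cases j <;> simp [matUnit]

/-- The infimum defining the norm runs over a nonempty set. This matters because the real infimum of
the empty set is 0. -/
theorem exists_mem_cone_two (x : V) : ∃ r : ℝ, 0 ≤ r ∧
    !![(r : ℂ) • (unit : V), x; star x, (r : ℂ) • (unit : V)] ∈ cone (V := V) 2 := by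
  obtain ⟨r, hr, h⟩ := exists_pos_add (ι := Fin 2) (A := !![0, x; star x, 0]) (by
    ext i j
    fin_cases i <;> fin_cases j <;> simp)
  refine ⟨r, hr.le, ?_⟩
  rw [smul_matUnit_two, pos_iff_mem] at h
  simpa using h

theorem norm_nonneg (x : V) : 0 ≤ norm x := Real.sInf_nonneg fun _ h => h.1

theorem norm_le {x : V} {r : ℝ} (hr : 0 ≤ r)
    (h : !![(r : ℂ) • (unit : V), x; star x, (r : ℂ) • (unit : V)] ∈ cone (V := V) 2) :
    norm x ≤ r :=
  csInf_le ⟨0, fun _ h => h.1⟩ ⟨hr, h⟩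

theorem exists_norm_smul_le (x : V) :
    ∃ M : ℝ, 0 ≤ M ∧ ∀ t : ℝ, 0 ≤ t → norm ((t : ℂ) • x) ≤ t * M := by
  obtain ⟨M, hM, h⟩ := exists_mem_cone_two x
  refine ⟨M, hM, fun t ht => norm_le (mul_nonneg ht hM) ?_⟩
  have := pos_iff_mem.1 ((pos_iff_mem.2 h).smul ht)
  simpa [smul_smul, -Complex.coe_smul] using this

theorem pos_of_norm_lt {x : V} {δ : ℝ} (h : norm x < δ) :
    Pos !![(δ : ℂ) • (unit : V), x; star x, (δ : ℂ) • (unit : V)] := by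
  obtain ⟨r, ⟨-, hr⟩, hrδ⟩ := exists_lt_of_csInf_lt (exists_mem_cone_two x) h
  have := (pos_iff_mem.2 hr).add
    ((pos_matUnit (V := V) (ι := Fin 2)).smul (sub_nonneg.2 hrδ.le))
  rw [smul_matUnit_two] at this
  convert this using 1
  ext i j
  fin_cases i <;> fin_cases j <;> simp [← add_smul, -Complex.coe_smul]

/-- A hermitian matrix with small entries is small in the order. -/
theorem pos_add_of_norm_lt {ι : Type*} [Fintype ι] [DecidableEq ι] {A : Matrix ι ι V}
    (hA : A.IsHermitian) {δ : ℝ} (h : ∀ i j, norm (A i j) < δ) :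
    Pos (((Fintype.card ι * δ : ℝ) : ℂ) • matUnit V ι + A) := by
  -- Each 2 × 2 block is placed on rows i and j. Summing over all pairs counts A twice and each
  -- diagonal δ 2·card times; hence the factor 1/2 below.
  have h1 : Pos (∑ i, ∑ j, matConj (Matrix.of fun a =>
      ![if a = i then (1 : ℂ) else 0, if a = j then 1 else 0])
      !![(δ : ℂ) • (unit : V), A i j; star (A i j), (δ : ℂ) • (unit : V)]) :=
    pos_sum _ fun i _ => pos_sum _ fun j _ => (pos_of_norm_lt (h i j)).matConj _
  have h2 := h1.smul (r := 1 / 2) (by norm_num)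
  convert h2 using 1
  ext a b
  have hab : star (A b a) = A a b := congrFun (congrFun hA a) b
  simp only [Matrix.smul_apply, Matrix.sum_apply, matConj_apply, Fin.sum_univ_two, Matrix.of_apply,
    Matrix.add_apply, Matrix.cons_val_zero, Matrix.cons_val_one, Matrix.cons_val', mul_ite, ite_smul,
    apply_ite star, mul_one, mul_zero, star_one, star_zero, one_smul, zero_smul,
    Finset.sum_add_distrib, Finset.sum_ite_irrel, Finset.sum_ite_eq, Finset.mem_univ, if_true,
    Finset.sum_const_zero, Finset.sum_const, Matrix.cons_val_fin_one]
  rw [hab]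
  by_cases hE : a = b
  · subst hE
    simp only [matUnit, Matrix.diagonal_apply_eq, if_true, Finset.card_univ,
      ← Nat.cast_smul_eq_nsmul ℂ]
    push_cast
    module
  · simp only [matUnit, Matrix.diagonal_apply_ne _ hE, hE, if_false]
    push_cast
    module

theorem exists_nonneg_add_sub {a : V} (ha : star a = a) :
    ∃ r : ℝ, 0 ≤ r ∧ Nonneg ((r : ℂ) • unit + a) ∧ Nonneg ((r : ℂ) • unit - a) := by
  have hC := isArchimedeanCone_nonneg (V := V)
  obtain ⟨r, hr⟩ := hC.order_unit ha
  obtain ⟨r', hr'⟩ := hC.order_unit (x := -a) (by rw [star_neg, ha])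
  refine ⟨|r| + |r'|, by positivity, ?_, ?_⟩
  · have h := hC.add_mem hr (hC.smul_mem (r := |r| + |r'| - r)
      (by linarith [le_abs_self r, abs_nonneg r']) hC.unit_mem)
    have e : ((|r| + |r'| : ℝ) : ℂ) • (unit : V) + a =
        (r : ℂ) • unit + a + ((|r| + |r'| - r : ℝ) : ℂ) • unit := by push_cast; module
    rw [e]
    exact h
  · have h := hC.add_mem hr' (hC.smul_mem (r := |r| + |r'| - r')
      (by linarith [le_abs_self r', abs_nonneg r]) hC.unit_mem)
    have e : ((|r| + |r'| : ℝ) : ℂ) • (unit : V) - a =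
        (r' : ℂ) • unit + -a + ((|r| + |r'| - r' : ℝ) : ℂ) • unit := by push_cast; module
    rw [e]
    exact h

end Norm

end OperatorSystem

open OperatorSystem

/-! ### Approximate factorization implies positivity from min to max. -/

section CompletelyPositive

variable {V W : Type*} [AddCommGroup V] [Module ℂ V] [StarAddMonoid V] [StarModule ℂ V]
  [OperatorSystem V] [AddCommGroup W] [Module ℂ W] [StarAddMonoid W] [StarModule ℂ W]
  [OperatorSystem W]

theorem IsUCP.pos_map {f : V →ₗ[ℂ] W} (hf : IsUCP f) {ι : Type*} [Fintype ι] {A : Matrix ι ι V}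
    (hA : Pos A) : Pos (A.map f) :=
  pos_iff_mem_card.2 (hf.2 _ _ (pos_iff_mem_card.1 hA))

theorem IsUCP.map_star {f : V →ₗ[ℂ] W} (hf : IsUCP f) (x : V) : f (star x) = star (f x) := by
  have key : ∀ y : V, star y = y → star (f y) = f y := fun y hy => by
    obtain ⟨r, hr⟩ := isArchimedeanCone_nonneg.order_unit hy
    have h := isArchimedeanCone_nonneg.star_eq (x := f ((r : ℂ) • unit + y)) (hf.pos_map hr)
    rw [map_add, map_smul, hf.1, star_add, star_smul, star_unit, Complex.star_def,
      Complex.conj_ofReal] at h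
    exact add_left_cancel h
  have h1 := key (x + star x) (by simp [add_comm])
  have h2 := key (Complex.I • (x - star x)) (by
    rw [star_smul, star_sub, star_star, Complex.star_def, Complex.conj_I, neg_smul, ← smul_neg,
      neg_sub])
  rw [map_add, star_add] at h1
  rw [map_smul, map_sub, star_smul, star_sub, Complex.star_def, Complex.conj_I, neg_smul,
    ← smul_neg, neg_sub] at h2
  have h3 := smul_right_injective W Complex.I_ne_zero h2
  have h4 : f (star x) = (1 / 2 : ℂ) • ((f x + f (star x)) - (f x - f (star x))) := by module
  rw [h4, ← h3, ← h1]
  module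

/-- Approximate factorization of a linear map through matrix algebras, in the point-norm
topology. -/
def ApproximatelyFactors (Φ : V →ₗ[ℂ] W) : Prop :=
  ∀ (F : Finset V) (δ : ℝ), 0 < δ → ∃ (N : ℕ) (φ : V →ₗ[ℂ] Matrix (Fin N) (Fin N) ℂ)
    (ψ : Matrix (Fin N) (Fin N) ℂ →ₗ[ℂ] W), IsUCP φ ∧ IsUCP ψ ∧
      ∀ x ∈ F, OperatorSystem.norm (ψ (φ x) - Φ x) < δ

theorem ApproximatelyFactors.isCompletelyPositive {Φ : V →ₗ[ℂ] W} (h : ApproximatelyFactors Φ)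
    (hΦ : IsUCP Φ) (R : Type*) [AddCommGroup R] [Module ℂ R] [StarAddMonoid R] [StarModule ℂ R]
    [OperatorSystem R] :
    IsCompletelyPositive (minCone R V) (maxCone R W) (TensorProduct.map LinearMap.id Φ) := by
  classical
  intro n X hX ε hε
  obtain ⟨σ, _, a, B, ha, hB, hXa⟩ := exists_isHermitian_of_mem_minCone hX
  choose r hr hra hra' using fun s => exists_nonneg_add_sub (ha s)
  have hrsum : 0 ≤ ∑ s, r s := Finset.sum_nonneg fun s _ => hr s
  -- Makes the total error Σ r_s δ at most ε; the 1 keeps the denominator positive.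
  set δ : ℝ := ε / (∑ s, r s + 1) with hδ
  have hδ0 : 0 < δ := by positivity
  -- Both signs are included because the order bound is needed for B_s and for −B_s.
  let F : Finset V := Finset.univ.image (fun p : σ × Fin n × Fin n => B p.1 p.2.1 p.2.2) ∪
    Finset.univ.image (fun p : σ × Fin n × Fin n => -B p.1 p.2.1 p.2.2)
  -- An n × n matrix with entries of norm below δ/(n + 1) is bounded in the order by nδ/(n + 1) ≤ δ.
  obtain ⟨N, φ, ψ, hφ, hψ, hF⟩ := h F (δ / (n + 1)) (by positivity)
  let Δ : V →ₗ[ℂ] W := Φ - ψ ∘ₗ φ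
  have hsmall : ∀ A : Matrix (Fin n) (Fin n) V, A.IsHermitian → (∀ i j, -A i j ∈ F) →
      Pos ((δ : ℂ) • matUnit W (Fin n) + A.map Δ) := fun A hA hAF => by
    have h1 := pos_add_of_norm_lt (A := A.map Δ) (δ := δ / (n + 1)) (by
      ext i j
      have := congrFun (congrFun hA i) j
      rw [Matrix.conjTranspose_apply] at this
      rw [Matrix.conjTranspose_apply, Matrix.map_apply, Matrix.map_apply, ← this]
      simp [Δ, hΦ.map_star, hφ.map_star, hψ.map_star]) (fun i j => by
      have := hF _ (hAF i j)
      rw [map_neg, map_neg, map_neg] at this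
      have e : Δ (A i j) = -ψ (φ (A i j)) - -Φ (A i j) := by
        simp only [Δ, LinearMap.sub_apply, LinearMap.comp_apply]
        abel
      rw [Matrix.map_apply, e]
      exact this)
    have h2 : 0 ≤ δ - Fintype.card (Fin n) * (δ / (n + 1)) := by
      rw [Fintype.card_fin, sub_nonneg, mul_div_assoc', div_le_iff₀ (by positivity)]
      nlinarith
    have h3 := h1.add ((pos_matUnit (V := W) (ι := Fin n)).smul h2)
    convert h3 using 1
    push_cast
    module
  have hs : ∀ s, ((r s * δ : ℝ) : ℂ) • tensorUnit R W n + tmulMatrix (a s) ((B s).map Δ) ∈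
      maxPreCone R W n := fun s =>
    smul_tensorUnit_add_tmulMatrix_mem (hra s) (hra' s)
      (hsmall _ (hB s) fun i j => Finset.mem_union_right _
        (Finset.mem_image_of_mem (fun p : σ × Fin n × Fin n => -B p.1 p.2.1 p.2.2)
          (Finset.mem_univ (s, i, j)))) (by
      have := hsmall (-B s) (hB s).neg fun i j => by
        rw [Matrix.neg_apply, neg_neg]
        exact Finset.mem_union_left _
          (Finset.mem_image_of_mem (fun p : σ × Fin n × Fin n => B p.1 p.2.1 p.2.2)
            (Finset.mem_univ (s, i, j)))
      convert this using 1
      ext i j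
      simp [sub_eq_add_neg])
  have hrest : 0 ≤ ε - ∑ s, r s * δ := by
    rw [← Finset.sum_mul, hδ, sub_nonneg, mul_div_assoc', div_le_iff₀ (by positivity)]
    nlinarith
  have hfin := add_mem_maxPreCone (add_mem_maxPreCone (map_mem_maxPreCone hφ hψ hX)
    (sum_mem_maxPreCone Finset.univ fun s _ => hs s))
    (smul_mem_maxPreCone (tensorUnit_mem_maxPreCone (V := R) (W := W) (n := n)) hrest)
  rw [← smul_tensorUnit]
  convert hfin using 1
  have e : X.map (TensorProduct.map LinearMap.id Φ) =
      X.map (TensorProduct.map LinearMap.id (ψ ∘ₗ φ)) +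
        ∑ s, tmulMatrix (a s) ((B s).map Δ) := by
    rw [hXa]
    ext i j
    simp [Matrix.sum_apply, tmulMatrix, Δ, TensorProduct.tmul_sub]
  rw [e, Finset.sum_add_distrib, ← Finset.sum_smul]
  push_cast
  module

end CompletelyPositive

theorem IsOrderUnitCone.eq_zero_of_forall_mem {W : Type*} [AddCommGroup W] [Module ℂ W]
    [StarAddMonoid W] [StarModule ℂ W] {C : Set W} {e : W} (hC : IsOrderUnitCone C e)
    {g : W →ₗ[ℂ] ℂ} (hg : ∀ x ∈ C, g x = 0) : g = 0 := by
  have key : ∀ y : W, star y = y → g y = 0 := fun y hy => by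
    obtain ⟨r, hr⟩ := hC.order_unit hy
    have h := hg _ hr
    rwa [map_add, map_smul, hg e hC.unit_mem, smul_zero, zero_add] at h
  ext x
  have h1 := key (x + star x) (by simp [add_comm])
  have h2 := key (Complex.I • (x - star x)) (by
    rw [star_smul, star_sub, star_star, Complex.star_def, Complex.conj_I, neg_smul, ← smul_neg,
      neg_sub])
  rw [map_add] at h1
  rw [map_smul, smul_eq_zero_iff_right Complex.I_ne_zero, map_sub] at h2
  rw [LinearMap.zero_apply]
  linear_combination (1 / 2 : ℂ) * h1 + (1 / 2 : ℂ) * h2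

namespace OperatorSystem

/-! ### Maps out of M_m given by positive matrices. -/

section Choi

variable {V : Type*} [AddCommGroup V] [Module ℂ V] [StarAddMonoid V] [StarModule ℂ V]
  [OperatorSystem V] {κ μ : Type*} [Fintype κ] [Fintype μ]

/-- Contracting a positive matrix over `V` against a positive semidefinite scalar matrix gives a
positive matrix. -/
theorem pos_contract {Q : Matrix μ μ V} (hQ : Pos Q) {B : Matrix (κ × μ) (κ × μ) ℂ}
    (hB : B.PosSemidef) :
    Pos (Matrix.of fun u v => ∑ i, ∑ j, B (u, i) (v, j) • Q i j : Matrix κ κ V) := by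
  classical
  -- Each rank-one summand of B turns the contraction into a compression of Q.
  obtain ⟨m, C, rfl⟩ := Matrix.posSemidef_iff_eq_sum_vecMulVec.1 hB
  have h : Pos (∑ w, matConj (Matrix.of fun u i => C w (u, i) : Matrix κ μ ℂ) Q) :=
    pos_sum _ fun w _ => hQ.matConj _
  convert h using 1
  ext u v
  simp only [Matrix.of_apply, Matrix.sum_apply, matConj_apply, Matrix.vecMulVec_apply,
    Finset.sum_smul, Pi.star_apply]
  calc _ = ∑ i, ∑ w, ∑ j, (C w (u, i) * star (C w (v, j))) • Q i j :=
        Finset.sum_congr rfl fun i _ => Finset.sum_comm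
    _ = _ := Finset.sum_comm

/-- The completely positive map `M_m → V` associated with a positive matrix over `V`. -/
def choiMap {m : ℕ} (Q : Matrix (Fin m) (Fin m) V) : Matrix (Fin m) (Fin m) ℂ →ₗ[ℂ] V where
  toFun A := ∑ i, ∑ j, A i j • Q i j
  map_add' A B := by simp [add_smul, Finset.sum_add_distrib]
  map_smul' r A := by simp [mul_smul, Finset.smul_sum]

theorem choiMap_isCompletelyPositive {m : ℕ} {Q : Matrix (Fin m) (Fin m) V} (hQ : Pos Q) :
    IsCompletelyPositive (cone (V := Matrix (Fin m) (Fin m) ℂ)) (cone (V := V)) (choiMap Q) :=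
  fun n A hA => by
    have h : (Matrix.comp (Fin n) (Fin n) (Fin m) (Fin m) ℂ A).PosSemidef := hA
    have h' := pos_iff_mem.1 (pos_contract hQ h)
    have e : A.map (choiMap Q) = Matrix.of fun u v => ∑ i, ∑ j, A u v i j • Q i j := rfl
    rw [e]
    exact h'

theorem nonneg_contract {Q : Matrix μ μ V} (hQ : Pos Q) {B : Matrix μ μ ℂ}
    (hB : B.PosSemidef) : Nonneg (∑ i, ∑ j, B i j • Q i j) := by
  have h := pos_contract (κ := Unit) hQ (hB.submatrix Prod.snd)
  simp only [Matrix.submatrix_apply] at h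
  exact h

end Choi

/-! ### The dual of a finite-dimensional operator system. -/

section Dual

variable {E : Type*} [AddCommGroup E] [Module ℂ E]

/-- A matrix of functionals, viewed as a map into matrices. -/
def evalMatrix {ι : Type*} (F : Matrix ι ι (Module.Dual ℂ E)) : E →ₗ[ℂ] Matrix ι ι ℂ where
  toFun x := Matrix.of fun i j => F i j x
  map_add' x y := by ext; simp
  map_smul' r x := by ext; simp

theorem evalMatrix_apply {ι : Type*} (F : Matrix ι ι (Module.Dual ℂ E)) (x : E) (i j : ι) :
    evalMatrix F x i j = F i j x := rfl

theorem pairing_evalMatrix {ι : Type*} [Fintype ι] (F : Matrix ι ι (Module.Dual ℂ E))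
    (A : Matrix ι ι E) : pairing (evalMatrix F) A = ∑ i, ∑ j, F i j (A i j) := rfl

theorem pairing_evalMatrix_smul_diagonal_add {ι : Type*} [Fintype ι] [DecidableEq ι] (r : ℂ)
    (f : Module.Dual ℂ E) (F : Matrix ι ι (Module.Dual ℂ E)) (A : Matrix ι ι E) :
    pairing (evalMatrix (Matrix.diagonal (fun _ => r • f) + F)) A =
      r * ∑ i, f (A i i) + ∑ i, ∑ j, F i j (A i j) := by
  simp only [pairing_evalMatrix, Matrix.add_apply, LinearMap.add_apply, Finset.sum_add_distrib]
  congr 1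
  rw [Finset.mul_sum]
  refine Finset.sum_congr rfl fun i _ => ?_
  rw [Finset.sum_eq_single i]
  · simp
  · intro j _ hj
    simp [Matrix.diagonal_apply_ne _ hj.symm]
  · simp

variable [StarAddMonoid E] [StarModule ℂ E]

/-- The involution `f ↦ f*`, `f*(x) = conj (f (x*))`, on the dual of a `*`-vector space. -/
instance dualStarAddMonoid : StarAddMonoid (Module.Dual ℂ E) where
  star f :=
    { toFun := fun x => star (f (star x))
      map_add' := fun x y => by simp
      map_smul' := fun r x => by simp [star_smul] }
  star_involutive f := by
    ext x
    change star (star (f (star (star x)))) = f x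
    rw [star_star, star_star]
  star_add f g := by
    ext x
    change star ((f + g) (star x)) = star (f (star x)) + star (g (star x))
    rw [LinearMap.add_apply, star_add]

theorem dual_star_apply (f : Module.Dual ℂ E) (x : E) : (star f) x = star (f (star x)) := rfl

instance dualStarModule : StarModule ℂ (Module.Dual ℂ E) where
  star_smul r f := by
    ext x
    rw [LinearMap.smul_apply, dual_star_apply, dual_star_apply, LinearMap.smul_apply, smul_eq_mul,
      star_mul', smul_eq_mul]

variable [OperatorSystem E]

theorem IsState.nonneg_contract {p : E →ₗ[ℂ] ℂ} (hp : IsState p) {ι : Type*} [Fintype ι]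
    {A : Matrix ι ι E} (hA : Pos A) {B : Matrix ι ι ℂ} (hB : B.PosSemidef) :
    0 ≤ ∑ i, ∑ j, B i j * p (A i j) := by
  simpa using hp.1 _ (OperatorSystem.nonneg_contract hA hB)

variable (E) in
-- States separate points, so their span has zero annihilator in E and, in finite dimension, is the
-- whole dual.
theorem exists_finset_states [FiniteDimensional ℂ E] :
    ∃ s : Finset (Module.Dual ℂ E), (∀ p ∈ s, IsState p) ∧
      Submodule.span ℂ (s : Set (Module.Dual ℂ E)) = ⊤ := by
  have htop : Submodule.span ℂ {p : Module.Dual ℂ E | IsState p} = ⊤ := by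
    rw [← Subspace.dualCoannihilator_dualAnnihilator_eq
      (W := Submodule.span ℂ {p : Module.Dual ℂ E | IsState p})]
    have : (Submodule.span ℂ {p : Module.Dual ℂ E | IsState p}).dualCoannihilator = ⊥ := by
      rw [eq_bot_iff]
      intro x hx
      rw [Submodule.mem_dualCoannihilator] at hx
      exact (Submodule.mem_bot ℂ).2
        (eq_zero_of_forall_isState fun p hp => hx p (Submodule.subset_span hp))
    rw [this, Submodule.dualAnnihilator_bot]
  obtain ⟨s, hs, hspan⟩ := (Submodule.fg_span_iff_fg_span_finset_subset _).1
    (htop ▸ Module.Finite.fg_top : (Submodule.span ℂ {p : Module.Dual ℂ E | IsState p}).FG)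
  exact ⟨s, hs, by rw [← hspan, htop]⟩

/-- A finite set of states spanning the dual. -/
noncomputable def spanningStates (E : Type*) [AddCommGroup E] [Module ℂ E] [StarAddMonoid E]
    [StarModule ℂ E] [OperatorSystem E] [FiniteDimensional ℂ E] : Finset (Module.Dual ℂ E) :=
  (exists_finset_states E).choose

theorem isState_of_mem_spanningStates [FiniteDimensional ℂ E] {p : Module.Dual ℂ E}
    (hp : p ∈ spanningStates E) : IsState p :=
  (exists_finset_states E).choose_spec.1 p hp

theorem span_spanningStates [FiniteDimensional ℂ E] :
    Submodule.span ℂ (spanningStates E : Set (Module.Dual ℂ E)) = ⊤ :=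
  (exists_finset_states E).choose_spec.2

/-- Expanding F over the spanning states p gives hermitian scalar coefficient matrices C_p. Each C_p
is bounded below by −R_p, and contracting C_p + R_p1 against A and then applying p gives a
nonnegative number. -/
theorem exists_dual_order_unit [FiniteDimensional ℂ E] {ι : Type*} [Fintype ι] [DecidableEq ι]
    {F : Matrix ι ι (Module.Dual ℂ E)} (hF : F.IsHermitian) :
    ∃ r : ℝ, 0 < r ∧ ∀ A : Matrix ι ι E, Pos A →
      0 ≤ (r : ℂ) * ∑ i, (∑ p ∈ spanningStates E, p) (A i i) + ∑ i, ∑ j, F i j (A i j) := by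
  have hspan : ∀ h : Module.Dual ℂ E, ∃ c : Module.Dual ℂ E → ℂ,
      h = ∑ p ∈ spanningStates E, c p • p := fun h => by
    have : h ∈ Submodule.span ℂ (spanningStates E : Set (Module.Dual ℂ E)) := by
      rw [span_spanningStates]; trivial
    obtain ⟨c, -, hc⟩ := Submodule.mem_span_finset.1 this
    exact ⟨c, hc.symm⟩
  choose c hc using fun i j => hspan (F i j)
  let C : Module.Dual ℂ E → Matrix ι ι ℂ := fun p =>
    Matrix.of fun i j => (1 / 2 : ℂ) * (c i j p + star (c j i p))
  have hC : ∀ p, (C p).IsHermitian := fun p => by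
    ext i j
    simp [C, add_comm]
  choose R hR hRC using fun p => exists_posSemidef_add_of_isHermitian (hC p)
  have hFC : ∀ i j, F i j = ∑ p ∈ spanningStates E, C p i j • p := fun i j => by
    have h1 : star (F j i) = ∑ p ∈ spanningStates E, star (c j i p) • p := by
      conv_lhs => rw [hc j i]
      rw [star_sum]
      refine Finset.sum_congr rfl fun p hp => ?_
      rw [star_smul]
      congr 1
      ext x
      rw [dual_star_apply, (isState_of_mem_spanningStates hp).map_star, star_star]
    have h2 : star (F j i) = F i j := congrFun (congrFun hF i) j
    have h3 : F i j = (1 / 2 : ℂ) • (F i j + star (F j i)) := by rw [h2]; module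
    rw [h3, h1]
    nth_rw 1 [hc i j]
    rw [← Finset.sum_add_distrib, Finset.smul_sum]
    refine Finset.sum_congr rfl fun p _ => ?_
    rw [← add_smul, smul_smul]
    rfl
  -- One constant dominates every R_p. The 1 keeps it positive when E = 0, where there are no
  -- states.
  refine ⟨1 + ∑ p ∈ spanningStates E, R p, by
    have := Finset.sum_nonneg fun p (_ : p ∈ spanningStates E) => (hR p).le
    linarith, fun A hA => ?_⟩
  set t := 1 + ∑ p ∈ spanningStates E, R p with ht
  have key : ∀ p ∈ spanningStates E,
      0 ≤ (t : ℂ) * ∑ i, p (A i i) + ∑ i, ∑ j, C p i j * p (A i j) := fun p hp => by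
    have hpS := isState_of_mem_spanningStates hp
    have hRt : 0 ≤ t - R p := by
      have := Finset.single_le_sum (fun q _ => (hR q).le) hp
      linarith
    have h1 := hpS.nonneg_contract hA (hRC p)
    have h2 : 0 ≤ ∑ i, p (A i i) := Finset.sum_nonneg fun i _ => hpS.1 _ (hA.nonneg_apply i)
    have h3 := add_nonneg (mul_nonneg (Complex.zero_le_real.2 hRt) h2) h1
    convert h3 using 1
    simp only [Matrix.add_apply, add_mul, Finset.sum_add_distrib, Matrix.diagonal_apply, ite_mul,
      zero_mul, Finset.sum_ite_eq, Finset.mem_univ, if_true, ← Finset.mul_sum]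
    push_cast
    ring
  have h := Finset.sum_nonneg key
  convert h using 1
  rw [Finset.sum_add_distrib, ← Finset.mul_sum]
  congr 1
  · congr 1
    simp only [LinearMap.sum_apply]
    exact Finset.sum_comm
  · simp only [hFC, LinearMap.sum_apply, LinearMap.smul_apply, smul_eq_mul]
    rw [Finset.sum_comm]
    calc _ = ∑ j, ∑ p ∈ spanningStates E, ∑ i, C p i j * p (A i j) :=
          Finset.sum_congr rfl fun j _ => Finset.sum_comm
      _ = ∑ p ∈ spanningStates E, ∑ j, ∑ i, C p i j * p (A i j) := Finset.sum_comm
      _ = _ := Finset.sum_congr rfl fun p _ => Finset.sum_comm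

/-- The dual of a finite-dimensional operator system is an operator system: the positive matrices
of functionals are the completely positive maps into matrix algebras, and a faithful positive
functional is an Archimedean matrix order unit. -/
noncomputable instance dualOperatorSystem [FiniteDimensional ℂ E] :
    OperatorSystem (Module.Dual ℂ E) where
  cone n := {F | PairingNonneg (evalMatrix F)}
  unit := ∑ p ∈ spanningStates E, p
  isHermitian_of_mem {n F} hF := by
    ext i j x
    rw [Matrix.conjTranspose_apply, dual_star_apply]
    have h : evalMatrix F (star x) j i = star (evalMatrix F x i j) := by
      rw [PairingNonneg.map_star hF, Matrix.conjTranspose_apply]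
    rw [← evalMatrix_apply F, h, star_star]
    rfl
  zero_mem n A _ := by simp [pairing_evalMatrix]
  add_mem {n F G} hF hG A hA := by
    have := add_nonneg (hF A hA) (hG A hA)
    simpa [pairing_evalMatrix, Finset.sum_add_distrib] using this
  conj_mem {m n} α F hF A hA := by
    -- Under the pairing, compressing F by α amounts to compressing A by the transpose of α.
    have h := hF _ (hA.matConj αᵀ)
    convert h using 1
    simp only [pairing_evalMatrix, matConj_apply, LinearMap.sum_apply, LinearMap.smul_apply,
      map_sum, map_smul, Matrix.transpose_apply]
    exact sum_sum_comm _
  eq_zero_of_mem_of_neg_mem {n F} hF hF' := by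
    have h := isArchimedeanCone_pos.toIsOrderUnitCone.eq_zero_of_forall_mem (g := pairing (evalMatrix F))
      fun A hA => le_antisymm (by
        have := hF' A hA
        rw [← neg_nonneg]
        simpa [pairing_evalMatrix] using this) (hF A hA)
    ext i j x
    rw [← evalMatrix_apply, ← pairing_single, h]
    rfl
  star_unit := by
    rw [star_sum]
    refine Finset.sum_congr rfl fun p hp => ?_
    ext x
    rw [dual_star_apply, (isState_of_mem_spanningStates hp).map_star, star_star]
  exists_order_unit {n F} hF := by
    obtain ⟨r, hr, h⟩ := exists_dual_order_unit hF
    refine ⟨r, hr, fun A hA => ?_⟩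
    rw [pairing_evalMatrix_smul_diagonal_add]
    exact h A hA
  archimedean {n F} hF h A hA := by
    have h' : ∀ r : ℝ, 0 < r → 0 ≤ (r : ℂ) * ∑ i, (∑ p ∈ spanningStates E, p) (A i i) +
        ∑ i, ∑ j, F i j (A i j) := fun r hr => by
      rw [← pairing_evalMatrix_smul_diagonal_add]
      exact h r hr A hA
    rw [pairing_evalMatrix]
    have ht : 0 ≤ ∑ i, (∑ p ∈ spanningStates E, p) (A i i) := Finset.sum_nonneg fun i _ => by
      rw [LinearMap.sum_apply]
      exact Finset.sum_nonneg fun p hp => (isState_of_mem_spanningStates hp).1 _ (hA.nonneg_apply i)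
    set z := ∑ i, ∑ j, F i j (A i j)
    set t := ∑ i, (∑ p ∈ spanningStates E, p) (A i i)
    obtain ⟨ht1, ht2⟩ := Complex.nonneg_iff.1 ht
    rw [Complex.nonneg_iff]
    constructor
    · by_contra! hz
      -- With Re z < 0, this r satisfies r·Re t ≤ −Re z / 2, so the real part of rt + z would be
      -- negative.
      have h1 := (Complex.nonneg_iff.1 (h' (-z.re / (2 * (t.re + 1))) (by
        apply div_pos <;> linarith))).1
      rw [Complex.add_re, Complex.re_ofReal_mul, div_mul_eq_mul_div, div_add' _ _ _ (by positivity),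
        div_nonneg_iff] at h1
      rcases h1 with ⟨h1, -⟩ | ⟨-, h1⟩ <;> nlinarith
    · have h1 := (Complex.nonneg_iff.1 (h' 1 one_pos)).2
      rw [Complex.add_im, Complex.im_ofReal_mul, ← ht2, mul_zero, zero_add] at h1
      exact h1

end Dual

end OperatorSystem

namespace OperatorSystem

/-! ### Finite-dimensional operator subsystems. -/

section GeneratedSystem

variable {V : Type*} [AddCommGroup V] [Module ℂ V] [StarAddMonoid V] [StarModule ℂ V]
  [OperatorSystem V]

/-- The operator subsystem generated by a finite set. -/
def generatedSystem (F : Finset V) : Submodule ℂ V :=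
  Submodule.span ℂ (↑F ∪ star '' ↑F ∪ {unit})

variable {F : Finset V}

theorem subset_generatedSystem {x : V} (hx : x ∈ F) : x ∈ generatedSystem F :=
  Submodule.subset_span (Or.inl (Or.inl hx))

theorem unit_mem_generatedSystem : unit ∈ generatedSystem F :=
  Submodule.subset_span (Or.inr rfl)

theorem star_mem_generatedSystem {x : V} (hx : x ∈ generatedSystem F) :
    star x ∈ generatedSystem F := by
  induction hx using Submodule.span_induction with
  | mem x hx =>
    rcases hx with (hx | ⟨y, hy, rfl⟩) | hx
    · exact Submodule.subset_span (Or.inl (Or.inr ⟨x, hx, rfl⟩))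
    · rw [star_star]
      exact subset_generatedSystem hy
    · rw [Set.mem_singleton_iff.1 hx, star_unit]
      exact unit_mem_generatedSystem
  | zero => rw [star_zero]; exact Submodule.zero_mem _
  | add x y _ _ hx hy => rw [star_add]; exact Submodule.add_mem _ hx hy
  | smul r x _ hx => rw [star_smul]; exact Submodule.smul_mem _ _ hx

instance generatedSystem.finiteDimensional : FiniteDimensional ℂ (generatedSystem F) :=
  FiniteDimensional.span_of_finite ℂ
    ((F.finite_toSet.union (F.finite_toSet.image star)).union (Set.finite_singleton _))

instance generatedSystem.starAddMonoid : StarAddMonoid (generatedSystem F) where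
  star x := ⟨star x, star_mem_generatedSystem x.2⟩
  star_involutive x := Subtype.ext (star_star (x : V))
  star_add x y := Subtype.ext (star_add (x : V) y)

instance generatedSystem.starModule : StarModule ℂ (generatedSystem F) where
  star_smul r x := Subtype.ext (star_smul r (x : V))

theorem generatedSystem.map_isHermitian_iff {ι : Type*} {A : Matrix ι ι (generatedSystem F)} :
    (A.map (generatedSystem F).subtype).IsHermitian ↔ A.IsHermitian := by
  constructor <;> intro h <;> ext i j
  · exact congrFun (congrFun h i) j
  · exact congrArg Subtype.val (congrFun (congrFun h i) j)

theorem generatedSystem.map_diagonal_add (n : ℕ) (r : ℂ)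
    (A : Matrix (Fin n) (Fin n) (generatedSystem F)) :
    (Matrix.diagonal (fun _ => r • (⟨unit, unit_mem_generatedSystem⟩ : generatedSystem F)) +
      A).map (generatedSystem F).subtype =
      Matrix.diagonal (fun _ => r • unit) + A.map (generatedSystem F).subtype := by
  ext i j
  by_cases h : i = j
  · subst h; simp
  · simp [h]

instance generatedSystem.operatorSystem : OperatorSystem (generatedSystem F) where
  cone n := {A | A.map (generatedSystem F).subtype ∈ cone n}
  unit := ⟨unit, unit_mem_generatedSystem⟩
  isHermitian_of_mem h := generatedSystem.map_isHermitian_iff.1 (isHermitian_of_mem h)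
  zero_mem n := by
    have : (0 : Matrix (Fin n) (Fin n) (generatedSystem F)).map (generatedSystem F).subtype = 0 :=
      rfl
    rw [Set.mem_ofPred_eq, this]
    exact zero_mem n
  add_mem hA hB := add_mem hA hB
  conj_mem α A hA := by
    rw [Set.mem_ofPred_eq, matConj_map]
    exact conj_mem α hA
  eq_zero_of_mem_of_neg_mem {n A} hA hA' := by
    have h : A.map (generatedSystem F).subtype = 0 := eq_zero_of_mem_of_neg_mem hA hA'
    ext i j
    exact congrFun (congrFun h i) j
  star_unit := Subtype.ext star_unit
  exists_order_unit hA := by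
    simp only [Set.mem_ofPred_eq, generatedSystem.map_diagonal_add]
    exact exists_order_unit (generatedSystem.map_isHermitian_iff.2 hA)
  archimedean hA h := by
    simp only [Set.mem_ofPred_eq, generatedSystem.map_diagonal_add] at h
    exact archimedean (generatedSystem.map_isHermitian_iff.2 hA) h

theorem generatedSystem.pos_map_iff {ι : Type*} [Fintype ι]
    {A : Matrix ι ι (generatedSystem F)} :
    Pos (A.map (generatedSystem F).subtype) ↔ Pos A := by
  rw [pos_iff_mem_card, pos_iff_mem_card]
  rfl

end GeneratedSystem

/-! ### Maps on E as tensors in E* ⊗ S, and the factorization they yield. -/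

section TensorOfMap

variable {E S T : Type*} [AddCommGroup E] [Module ℂ E] [FiniteDimensional ℂ E]
  [AddCommGroup S] [Module ℂ S] [AddCommGroup T] [Module ℂ T]

/-- The tensor in `E* ⊗ S` of a linear map `E → S`. -/
noncomputable def tensorOfMap (j : E →ₗ[ℂ] S) : Module.Dual ℂ E ⊗[ℂ] S :=
  ∑ i, (Module.finBasis ℂ E).coord i ⊗ₜ[ℂ] j (Module.finBasis ℂ E i)

theorem sliceLeft_map_tensorOfMap (j : E →ₗ[ℂ] S) (Φ : S →ₗ[ℂ] T) (x : E) :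
    sliceLeft T (Module.Dual.eval ℂ E x) (TensorProduct.map LinearMap.id Φ (tensorOfMap j)) =
      Φ (j x) := by
  have h := (Module.finBasis ℂ E).sum_repr x
  simp only [tensorOfMap, map_sum, TensorProduct.map_tmul, LinearMap.id_coe, id_eq, sliceLeft_tmul,
    Module.Dual.eval_apply, Module.Basis.coord_apply, ← map_smul]
  rw [← map_sum, ← map_sum, h]

end TensorOfMap

section Factorization

variable {E S T : Type*} [AddCommGroup E] [Module ℂ E] [StarAddMonoid E] [StarModule ℂ E]
  [OperatorSystem E] [FiniteDimensional ℂ E]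
  [AddCommGroup S] [Module ℂ S] [StarAddMonoid S] [StarModule ℂ S] [OperatorSystem S]
  [AddCommGroup T] [Module ℂ T] [StarAddMonoid T] [StarModule ℂ T] [OperatorSystem T]

/-- A completely positive map defined on a finite-dimensional operator system `E` corresponds to a
positive element of `E* ⊗_min S`. -/
theorem tensorOfMap_mem_minCone {j : E →ₗ[ℂ] S}
    (hj : ∀ (n : ℕ) (A : Matrix (Fin n) (Fin n) E), Pos A → Pos (A.map j)) :
    (Matrix.of fun _ _ => tensorOfMap j) ∈ minCone (Module.Dual ℂ E) S 1 := by
  intro k m φ ψ hφ hψ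
  let b := Module.finBasis ℂ E
  -- By reflexivity φ : E* → M_k is a matrix A over E, and (φ ⊗ ψ) of the tensor is ψ applied to
  -- j(A). A positive functional g on M_k(E) is a positive matrix G over E*, and g(A) is the pairing
  -- of φ with G, so positivity of φ gives positivity of A.
  let A : Matrix (Fin k) (Fin k) E := Matrix.of fun c d => ∑ i, φ (b.coord i) c d • b i
  have hA : Pos A := by
    refine isArchimedeanCone_pos.mem_of_forall_state fun g hg _ => ?_
    let G : Matrix (Fin k) (Fin k) (Module.Dual ℂ E) := Matrix.of fun c d =>
      g ∘ₗ Matrix.singleLinearMap ℂ c d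
    have hG : G ∈ cone (V := Module.Dual ℂ E) k := fun B hB => by
      have e : evalMatrix G = ofFunctional g := rfl
      rw [e, pairing_ofFunctional]
      exact hg B hB
    have h := pairing_nonneg_of_posSemidef (hφ.2 k G hG)
    convert h using 1
    rw [pairing_apply]
    conv_lhs => rw [Matrix.matrix_eq_sum_single A]
    simp only [map_sum]
    refine Finset.sum_congr rfl fun c _ => Finset.sum_congr rfl fun d _ => ?_
    conv_rhs => rw [← b.sum_dual_apply_smul_coord (G c d)]
    change (g ∘ₗ Matrix.singleLinearMap ℂ c d) (A c d) = _
    simp only [A, Matrix.of_apply, map_sum, map_smul, Matrix.sum_apply, Matrix.smul_apply,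
      smul_eq_mul]
    exact Finset.sum_congr rfl fun i _ => mul_comm _ _
  have h := (PairingNonneg.posSemidef_comp (isCompletelyPositive_iff_pairingNonneg.1 hψ.2)
    (hj k A hA)).submatrix (Prod.snd : Fin 1 × (Fin k × Fin m) → Fin k × Fin m)
  convert h using 1
  ext ⟨_, c, a⟩ ⟨_, d, a'⟩
  simp [A, b, tensorOfMap, tensorToMatrix_tmul, Matrix.sum_apply]

/-- If `id ⊗ Φ : E* ⊗_min S → E* ⊗_max T` is positive, then `Φ` approximately factors through
matrix algebras on `E`. -/
theorem exists_factorization {j : E →ₗ[ℂ] S} (hinj : Function.Injective j)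
    (hunit : j unit = unit) (hstar : ∀ x, j (star x) = star (j x))
    (hpos : ∀ (n : ℕ) (A : Matrix (Fin n) (Fin n) E), Pos (A.map j) ↔ Pos A)
    {Φ : S →ₗ[ℂ] T}
    (hΦ : IsCompletelyPositive (minCone (Module.Dual ℂ E) S) (maxCone (Module.Dual ℂ E) T)
      (TensorProduct.map LinearMap.id Φ)) {ε : ℝ} (hε : 0 < ε) :
    ∃ (m : ℕ) (φ : S →ₗ[ℂ] Matrix (Fin m) (Fin m) ℂ) (Q : Matrix (Fin m) (Fin m) T),
      IsUCP φ ∧ Pos Q ∧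
      ∀ x : E, choiMap Q (φ (j x)) =
        Φ (j x) + ((ε : ℂ) * (unit : Module.Dual ℂ E) x) • unit := by
  obtain ⟨k, l, P, Q, α, hP, hQ, h⟩ :=
    hΦ 1 _ (tensorOfMap_mem_minCone fun n A hA => (hpos n A).2 hA) ε hε
  obtain ⟨φ₁, hφ₁, hφ₁P⟩ := PairingNonneg.exists_extension j hinj hunit hstar
    (fun A hA => (hpos k A).1 hA) (φ := evalMatrix P) hP
  obtain ⟨m, φ, β, hφ, hβ⟩ := hφ₁.exists_isUCP
  -- Since P(x) = βφ(x)β* on E, both α and β can be absorbed into Q, leaving a single Choi map after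
  -- φ.
  let γ : Matrix (Fin m) (Fin l) ℂ := Matrix.of fun s a => ∑ i, α 0 (i, a) * β i s
  refine ⟨m, φ, matConj γ Q, hφ, (pos_iff_mem.2 hQ).matConj γ, fun x => ?_⟩
  have h0 := congrArg (sliceLeft T (Module.Dual.eval ℂ E x)) (congrFun (congrFun h 0) 0)
  rw [Matrix.add_apply, map_add, Matrix.map_apply, Matrix.of_apply, sliceLeft_map_tensorOfMap,
    Matrix.diagonal_apply_eq, map_smul, sliceLeft_tmul, Module.Dual.eval_apply, smul_smul] at h0
  rw [h0, matConj_apply]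
  simp only [map_sum, map_smul, Matrix.kroneckerMap_apply, sliceLeft_tmul, Module.Dual.eval_apply,
    Fintype.sum_prod_type]
  have hPx : ∀ i i', P i i' x = ∑ s, ∑ s', φ (j x) s s' * (β i s * star (β i' s')) :=
    fun i i' => by
    rw [← evalMatrix_apply, ← hφ₁P, hβ]
    simp only [Matrix.mul_apply, Matrix.conjTranspose_apply, Finset.sum_mul]
    rw [Finset.sum_comm]
    exact Finset.sum_congr rfl fun s _ => Finset.sum_congr rfl fun s' _ => by ring
  have hL : choiMap (matConj γ Q) (φ (j x)) = ∑ a, ∑ a',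
      (∑ s, ∑ s', φ (j x) s s' * (γ s a * star (γ s' a'))) • Q a a' := by
    simp only [Finset.sum_smul, mul_smul _ (_ * _)]
    rw [sum_sum_comm]
    simp only [← Finset.smul_sum]
    rfl
  rw [hL]
  have hR : ∀ f : Fin k → Fin l → Fin k → Fin l → T, ∑ i, ∑ a, ∑ i', ∑ a', f i a i' a' =
      ∑ a, ∑ a', ∑ i, ∑ i', f i a i' a' := fun f => by
    rw [Finset.sum_comm]
    refine Finset.sum_congr rfl fun a _ => ?_
    calc _ = ∑ i, ∑ a', ∑ i', f i a i' a' := Finset.sum_congr rfl fun i _ => Finset.sum_comm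
      _ = _ := Finset.sum_comm
  rw [hR]
  refine Finset.sum_congr rfl fun a _ => Finset.sum_congr rfl fun a' _ => ?_
  simp only [smul_smul, ← Finset.sum_smul]
  congr 1
  simp only [hPx, Finset.mul_sum]
  rw [sum_sum_comm]
  refine Finset.sum_congr rfl fun s _ => Finset.sum_congr rfl fun s' _ => ?_
  simp only [γ, Matrix.of_apply, star_sum, star_mul']
  rw [Finset.sum_mul_sum]
  simp only [Finset.mul_sum]
  exact Finset.sum_congr rfl fun i _ => Finset.sum_congr rfl fun i' _ => by ring

end Factorization

end OperatorSystem

/-! ### Normalisation to unital maps, and the equivalence. -/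

theorem approximatelyFactors_of_dual {S T : Type*}
    [AddCommGroup S] [Module ℂ S] [StarAddMonoid S] [StarModule ℂ S] [OperatorSystem S]
    [AddCommGroup T] [Module ℂ T] [StarAddMonoid T] [StarModule ℂ T] [OperatorSystem T]
    {Φ : S →ₗ[ℂ] T} (hΦ1 : Φ unit = unit)
    (hΦ : ∀ F : Finset S, IsCompletelyPositive (minCone (Module.Dual ℂ (generatedSystem F)) S)
      (maxCone (Module.Dual ℂ (generatedSystem F)) T) (TensorProduct.map LinearMap.id Φ)) :
    ApproximatelyFactors Φ := by
  intro F δ hδ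
  let f : generatedSystem F → ℂ := fun x => (unit : Module.Dual ℂ (generatedSystem F)) x
  let c : ℝ := (f unit).re
  have hf : 0 ≤ f unit := by
    have hC := isArchimedeanCone_nonneg (V := generatedSystem F)
    change 0 ≤ (∑ p ∈ spanningStates (generatedSystem F), p) unit
    rw [LinearMap.sum_apply]
    exact Finset.sum_nonneg fun p hp => (isState_of_mem_spanningStates hp).1 _ hC.unit_mem
  have hc0 : 0 ≤ c := (Complex.nonneg_iff.1 hf).1
  have hc : f unit = (c : ℂ) := Complex.ext rfl (by simp [← (Complex.nonneg_iff.1 hf).2])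
  choose M hM0 hM using fun x : generatedSystem F =>
    exists_norm_smul_le (f x • (unit : T) - (c : ℂ) • Φ x)
  let K : ℝ := ∑ x : F, M ⟨x.1, subset_generatedSystem x.2⟩
  have hK : 0 ≤ K := Finset.sum_nonneg fun x _ => hM0 _
  -- K dominates the norm bounds of f(x)1 − cΦ(x) for every x in F, so the final error is at most εK
  -- < δ.
  let ε : ℝ := δ / (K + 1)
  have hε : 0 < ε := by positivity
  obtain ⟨m, φ, Q, hφ, hQ, hQφ⟩ := exists_factorization (j := (generatedSystem F).subtype)
    Subtype.val_injective rfl (fun _ => rfl) (fun n A => generatedSystem.pos_map_iff) (hΦ F) hε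
  have hd : 0 < 1 + ε * c := by positivity
  have hdC : (1 + (ε : ℂ) * c) ≠ 0 := by exact_mod_cast hd.ne'
  -- At the unit the factorization gives 1 + εf(1) = 1 + εc, so dividing by this makes the second
  -- map unital.
  refine ⟨m, φ, (((1 + ε * c)⁻¹ : ℝ) : ℂ) • choiMap Q, hφ, ⟨?_, fun n A hA => ?_⟩, fun x hx => ?_⟩
  · have h := hQφ unit
    change choiMap Q (φ unit) = Φ unit + ((ε : ℂ) * f unit) • unit at h
    rw [hφ.1, hΦ1, hc] at h
    rw [LinearMap.smul_apply, h]
    push_cast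
    rw [smul_add, smul_smul, ← add_smul]
    conv_rhs => rw [← one_smul ℂ (unit : T)]
    congr 1
    field_simp
  · have h := (pos_iff_mem.2 (choiMap_isCompletelyPositive hQ n A hA)).smul (inv_nonneg.2 hd.le)
    rw [← pos_iff_mem]
    exact h
  · have h := hQφ ⟨x, subset_generatedSystem hx⟩
    change choiMap Q (φ x) = Φ x + ((ε : ℂ) * f ⟨x, subset_generatedSystem hx⟩) • unit at h
    have e : ((((1 + ε * c)⁻¹ : ℝ) : ℂ) • choiMap Q) (φ x) - Φ x =
        ((ε / (1 + ε * c) : ℝ) : ℂ) •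
          (f ⟨x, subset_generatedSystem hx⟩ • (unit : T) - (c : ℂ) • Φ x) := by
      rw [LinearMap.smul_apply, h]
      have e1 : Φ x = (((1 + ε * c)⁻¹ : ℝ) : ℂ) • ((1 + (ε : ℂ) * c) • Φ x) := by
        rw [smul_smul]
        push_cast
        rw [inv_mul_cancel₀ hdC, one_smul]
      conv_lhs => rw [sub_eq_add_neg]; rhs; rw [e1]
      push_cast
      rw [div_eq_mul_inv]
      module
    rw [e]
    refine (hM ⟨x, subset_generatedSystem hx⟩ _ (by positivity)).trans_lt ?_
    have h1 : M ⟨x, subset_generatedSystem hx⟩ ≤ K :=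
      Finset.single_le_sum (f := fun x : F => M ⟨x.1, subset_generatedSystem x.2⟩)
        (fun x _ => hM0 _) (Finset.mem_univ ⟨x, hx⟩)
    have h2 : ε / (1 + ε * c) ≤ ε := div_le_self hε.le (by nlinarith [mul_nonneg hε.le hc0])
    calc _ ≤ ε * K := mul_le_mul h2 h1 (hM0 _) hε.le
      _ < ε * (K + 1) := by nlinarith
      _ = δ := div_mul_cancel₀ _ (by positivity)

theorem approximatelyFactors_iff_exists_net {S T : Type u}
    [AddCommGroup S] [Module ℂ S] [StarAddMonoid S] [StarModule ℂ S] [OperatorSystem S]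
    [AddCommGroup T] [Module ℂ T] [StarAddMonoid T] [StarModule ℂ T] [OperatorSystem T]
    {Φ : S →ₗ[ℂ] T} : ApproximatelyFactors Φ ↔
      ∃ (Λ : Type u) (_ : Preorder Λ) (_ : IsDirectedOrder Λ) (_ : Nonempty Λ) (n : Λ → ℕ)
        (φ : (l : Λ) → S →ₗ[ℂ] Matrix (Fin (n l)) (Fin (n l)) ℂ)
        (ψ : (l : Λ) → Matrix (Fin (n l)) (Fin (n l)) ℂ →ₗ[ℂ] T),
        (∀ l, IsUCP (φ l)) ∧ (∀ l, IsUCP (ψ l)) ∧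
        ∀ x : S, Tendsto (fun l => OperatorSystem.norm (ψ l (φ l x) - Φ x)) atTop (𝓝 0) := by
  classical
  constructor
  · intro h
    choose n φ ψ hφ hψ hF using fun l : Finset S × ℕ =>
      h l.1 (1 / ((l.2 : ℝ) + 1)) (by positivity)
    -- The net is indexed by finite sets together with tolerances 1/(k + 1).
    refine ⟨Finset S × ℕ, inferInstance, inferInstance, inferInstance, n, φ, ψ, hφ, hψ,
      fun x => ?_⟩
    have hlim : Tendsto (fun l : Finset S × ℕ => 1 / ((l.2 : ℝ) + 1)) atTop (𝓝 0) := by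
      rw [← prod_atTop_atTop_eq]
      exact tendsto_one_div_add_atTop_nhds_zero_nat.comp tendsto_snd
    refine squeeze_zero' (Eventually.of_forall fun l => norm_nonneg _) ?_ hlim
    filter_upwards [eventually_ge_atTop (({x}, 0) : Finset S × ℕ)] with l hl
    exact (hF l x (hl.1 (Finset.mem_singleton_self x))).le
  · rintro ⟨Λ, _, _, _, n, φ, ψ, hφ, hψ, h⟩ F δ hδ
    obtain ⟨l, hl⟩ := ((Finset.eventually_all F).2 fun x _ =>
      (h x).eventually_lt_const hδ).exists
    exact ⟨n l, φ l, ψ l, hφ l, hψ l, hl⟩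

theorem theorem3p1 {S T : Type u}
    [AddCommGroup S] [Module ℂ S] [StarAddMonoid S] [StarModule ℂ S] [OperatorSystem S]
    [AddCommGroup T] [Module ℂ T] [StarAddMonoid T] [StarModule ℂ T] [OperatorSystem T]
    (Φ : S →ₗ[ℂ] T) (hΦ : IsUCP Φ) :
    List.TFAE [
      ∀ (R : Type u) [AddCommGroup R] [Module ℂ R] [StarAddMonoid R] [StarModule ℂ R]
        [OperatorSystem R],
        IsCompletelyPositive (minCone R S) (maxCone R T) (TensorProduct.map LinearMap.id Φ),
      ∀ (E : Type u) [AddCommGroup E] [Module ℂ E] [StarAddMonoid E] [StarModule ℂ E]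
        [OperatorSystem E] [FiniteDimensional ℂ E],
        IsCompletelyPositive (minCone E S) (maxCone E T) (TensorProduct.map LinearMap.id Φ),
      ∃ (Λ : Type u) (_ : Preorder Λ) (_ : IsDirectedOrder Λ) (_ : Nonempty Λ) (n : Λ → ℕ)
        (φ : (l : Λ) → S →ₗ[ℂ] Matrix (Fin (n l)) (Fin (n l)) ℂ)
        (ψ : (l : Λ) → Matrix (Fin (n l)) (Fin (n l)) ℂ →ₗ[ℂ] T),
        (∀ l, IsUCP (φ l)) ∧ (∀ l, IsUCP (ψ l)) ∧
        ∀ x : S, Tendsto (fun l => OperatorSystem.norm (ψ l (φ l x) - Φ x)) atTop (𝓝 0)] := by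
  rw [← approximatelyFactors_iff_exists_net]
  tfae_have 1 → 2 := fun h E => h E
  -- Only the duals of finitely generated subsystems of S are tested, and these live in the same
  -- universe as S.
  tfae_have 2 → 3 := fun h => approximatelyFactors_of_dual hΦ.1 fun F =>
    h (Module.Dual ℂ (generatedSystem F))
  tfae_have 3 → 1 := fun h R => h.isCompletelyPositive hΦ R
  tfae_finish
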